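/- **Model.** For $K\ge 1$ consider the fully connected $K$-user Gaussian interference channel $$Y_i(t)=\sum_{j=1}^K H_{ij}(t)X_j(t)+Z_i(t),\qquad i\in[K]=\{1,\dots,K\},\ t=1,2,\dots,$$ with complex signals, where the noise $Z_i(t)$ is circularly symmetric complex Gaussian with mean $0$ and variance $1$, independent over $t$. The coefficients are drawn independently from a fixed continuous (that is, atomless) probability law $\mu$ on $\mathbb C$. In the *constant* channel the $H_{ij}(t)=H_{ij}$ do not depend on $t$ and the $K^2$ numbers $H_{ij}$ are independent with law $\mu$; in the *time-varying* channel all $H_{ij}(t)$, over $i,j,t$, are independent with law $\mu$. The realization of the whole coefficient array is known to all encoders and decoders. Message $W_i$, intended for receiver $i$, is available exactly at the transmitters in a transmit set $\mathcal T_i\subseteq[K]$. The messages are independent and uniform on finite alphabets $\mathcal W_i$. In a code of block length $n$ the signal of transmitter $j$ is a function of $\{W_i: j\in\mathcal T_i\}$, it has power at most $P$ on average over the block and the messages, and receiver $i$ estimates $W_i$ from $Y_i(1),\dots,Y_i(n)$ by a measurable map. Rates $R_i(P)\ge 0$ are achievable if, for almost all channel realizations, the following holds: for every $\varepsilon>0$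 and all large enough $n$ there is a code of block length $n$ with $\frac{\log|\mathcal W_i|}{n}\ge R_i(P)$ and error probability at most $\varepsilon$ for every message $i$. A tuple $(d_i)_{i\in[K]}$ is an achievable tuple of degrees of freedom (DoF) if $d_i=\lim_{P\to\infty}R_i(P)/\log P$ for some rates $R_i(P)$ achievable for every $P>0$; the DoF region is the closure of the set of achievable tuples, and $\eta$ is the supremum of $\sum_i d_i$ over the region. Let $\eta(K,M)$ be the supremum of $\eta$ over all choices of transmit sets with $|\mathcal T_i|\le M$ for all $i$, and let $$\tau(M)=\limsup_{K\to\infty}\frac{\eta(K,M)}{K}$$ (which equals the limit whenever the limit exists). **Theorem.** If each message is available at a maximum of three transmitters, the asymptotic per user DoF of the fully connected channel satisfies $$\tau(3)\le\frac58 .$$ This holds for the constant channel with every atomless law $\mu$, and for the time-varying channel with every atomless law $\mu$ such that $\int\max(\log|h|,0)\,d\mu(h)<\infty$. -/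

import Mathlib

open MeasureTheory ProbabilityTheory Filter Topology
open scoped ENNReal NNReal

noncomputable section

namespace CoMP

/-- The circularly symmetric complex Gaussian law with mean zero and unit variance: real and
imaginary parts are independent real Gaussians of variance `1 / 2`. -/
def stdComplexGaussian : Measure ℂ :=
  ((gaussianReal 0 (1 / 2)).prod (gaussianReal 0 (1 / 2))).map Complex.measurableEquivRealProd.symm

/-- The law of the noise seen by one receiver during `n` time slots: independent over time. Each
error event concerns a single receiver, so only these marginal laws of the noise matter. -/
def noiseLaw (n : ℕ) : Measure (Fin n → ℂ) :=
  Measure.pi fun _ => stdComplexGaussian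

/-- Channel realizations of a `K`-user channel: `H t i j` is the coefficient from transmitter `j`
to receiver `i` in time slot `t`. -/
abbrev Realization (K : ℕ) : Type := ℕ → Fin K → Fin K → ℂ

/-- A fully connected `K × K` array of coefficients drawn independently from the law `μ`. -/
def coeffLaw (μ : Measure ℂ) (K : ℕ) : Measure (Fin K → Fin K → ℂ) :=
  Measure.pi fun _ => Measure.pi fun _ => μ

instance (μ : Measure ℂ) [IsProbabilityMeasure μ] (K : ℕ) :
    IsProbabilityMeasure (coeffLaw μ K) := by
  unfold coeffLaw; infer_instance

/-- The fully connected channel whose coefficients are drawn once and then stay constant. -/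
def constantChannel (μ : Measure ℂ) (K : ℕ) : Measure (Realization K) :=
  (coeffLaw μ K).map fun H _ => H

/-- The fully connected channel whose coefficients are drawn afresh in every time slot,
independently over time. -/
def varyingChannel (μ : Measure ℂ) [IsProbabilityMeasure μ] (K : ℕ) : Measure (Realization K) :=
  Measure.infinitePi fun _ : ℕ => coeffLaw μ K

/-- A coding scheme of block length `n` for the transmit sets `T`, where `T i` is the set of
transmitters that know message `i`. Message `i` takes `size i` values. -/
structure Code {K : ℕ} (T : Fin K → Finset (Fin K)) (n : ℕ) where
  size : Fin K → ℕ
  size_pos : ∀ i, 0 < size i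
  /-- The codeword that transmitter `j` sends for a tuple of messages. -/
  enc : Fin K → ((i : Fin K) → Fin (size i)) → Fin n → ℂ
  /-- Transmitter `j` uses only the messages that are available to it. -/
  enc_local : ∀ j w w', (∀ i, j ∈ T i → w i = w' i) → enc j w = enc j w'
  /-- Receiver `i` estimates message `i` from what it receives. -/
  dec : (i : Fin K) → (Fin n → ℂ) → Fin (size i)
  measurable_dec : ∀ i, Measurable (dec i)

namespace Code

variable {K : ℕ} {T : Fin K → Finset (Fin K)} {n : ℕ}

/-- The number of message tuples. -/
def numMessages (c : Code T n) : ℕ := ∏ i, c.size i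

/-- The rate of message `i`. -/
def rate (c : Code T n) (i : Fin K) : ℝ := Real.log (c.size i) / n

/-- The average power of transmitter `j`: the mean over the block and over the messages, which are
independent and uniformly distributed. -/
def power (c : Code T n) (j : Fin K) : ℝ :=
  (∑ w, (∑ t, ‖c.enc j w t‖ ^ 2) / n) / c.numMessages

/-- The noiseless part of what receiver `i` receives. -/
def signal (c : Code T n) (H : Realization K) (i : Fin K)
    (w : (i : Fin K) → Fin (c.size i)) (t : Fin n) : ℂ :=
  ∑ j, H t i j * c.enc j w t

/-- The probability, over messages and noise, that receiver `i` decodes its message wrongly. -/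
def errorProb (c : Code T n) (H : Realization K) (i : Fin K) : ℝ :=
  (∑ w, (noiseLaw n).real {z | c.dec i (fun t => c.signal H i w t + z t) ≠ w i}) / c.numMessages

end Code

/-- The rates `R` are achievable with power `P` over the channel realization `H`: for all large
block lengths there are codes of at least these rates whose error probabilities are simultaneously
arbitrarily small. -/
def AchievableRate {K : ℕ} (T : Fin K → Finset (Fin K)) (H : Realization K) (P : ℝ)
    (R : Fin K → ℝ) : Prop :=
  ∀ ε > 0, ∃ N : ℕ, ∀ n ≥ N, ∃ c : Code T n,
    (∀ j, c.power j ≤ P) ∧ (∀ i, R i ≤ c.rate i) ∧ ∀ i, c.errorProb H i ≤ ε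

/-- `d` is an achievable tuple of degrees of freedom: there are rates `R P`, achievable with power
`P` for almost all channel realizations, such that `R P i / log P → d i` as `P → ∞`. -/
def AchievableDoF {K : ℕ} (law : Measure (Realization K)) (T : Fin K → Finset (Fin K))
    (d : Fin K → ℝ) : Prop :=
  ∃ R : ℝ → Fin K → ℝ,
    (∀ P > 0, (∀ i, 0 ≤ R P i) ∧ ∀ᵐ H ∂law, AchievableRate T H P (R P)) ∧
    ∀ i, Tendsto (fun P => R P i / Real.log P) atTop (𝓝 (d i))

/-- The region of degrees of freedom for the transmit sets `T`. -/
def dofRegion {K : ℕ} (law : Measure (Realization K)) (T : Fin K → Finset (Fin K)) :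
    Set (Fin K → ℝ) :=
  closure {d | AchievableDoF law T d}

/-- The total number of degrees of freedom for the transmit sets `T`, a supremum in `[0, ∞]`. -/
def dof {K : ℕ} (law : Measure (Realization K)) (T : Fin K → Finset (Fin K)) : ℝ≥0∞ :=
  ⨆ d ∈ dofRegion law T, ENNReal.ofReal (∑ i, d i)

/-- `η(K, M)`: the best total number of degrees of freedom over all choices of transmit sets in
which every message is available at no more than `M` transmitters. -/
def dofCoop {K : ℕ} (law : Measure (Realization K)) (M : ℕ) : ℝ≥0∞ :=
  ⨆ (T : Fin K → Finset (Fin K)) (_ : ∀ i, (T i).card ≤ M), dof law T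

/-- `τ(M)`: the asymptotic per user degrees of freedom of a sequence of `K`-user channels. The
upper limit is the limit of `η(K, M) / K` whenever the latter exists. -/
def tau (law : (K : ℕ) → Measure (Realization K)) (M : ℕ) : ℝ≥0∞ :=
  limsup (fun K : ℕ => dofCoop (law K) M / (K : ℝ≥0∞)) atTop

end CoMP

end

/-!
The bound rests on a choice of receivers and on a packing argument.

Let `A` be a set of receivers such that all messages of the other receivers live on a set `V` of
only `#A` transmitters. The outputs in `A` then determine all messages: the decisions of the
receivers in `A` reveal every input outside `V`, and what remains of the outputs in `A` is an
invertible image of the inputs in `V` plus noise, from which all other outputs can be predicted up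
to noise of a power that does not grow with the transmit power. So the total number of degrees of
freedom is at most `#A` (`dof_le_card`). For transmit sets of at most three elements, deleting
transmitters of least degree one at a time leaves such a set with `#A = 5 K / 8 + O(1)`
(`exists_receivers_card_eq`).

The bound `#A` needs no entropy. The noise has density at most `1`, and the events of correct
decoding are disjoint for different messages, so the number of messages is at most about the volume
of the set of outputs that are both typical and well predicted (`Code.sum_prob_le`,
`Code.numMessages_le`). Subtracting the prediction is a shear and preserves volume
(`lintegral_prod_sub_shear`), so this set is no larger than an ellipsoid: each output in `A`
contributes `log P` per time slot, each predicted output a constant. The loss against an entropy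
argument is a constant factor per time slot, which does not affect degrees of freedom.

A predictor exists as soon as a square subchannel is invertible. This holds almost surely for every
atomless law (`ae_det_ne_zero`), and suffices for the constant channel. In the time-varying channel
the logarithm of the gain of the inverse need not be integrable. There the outputs are left
unpredicted, at a cost of `log P` each, in the time slots where the gain of the inverse exceeds a
threshold; by the law of large numbers the frequency of those slots tends to zero as the threshold
grows (`ae_isRegular_varyingChannel`).
-/

noncomputable section

namespace CoMP

/-! ### Sparse families of transmit sets -/

section Combinatorics

variable {α ι : Type*} [DecidableEq α] {T : ι → Finset α} {r : ℕ}

/-- If the sets `T i`, `i ∈ E`, have at most `r` points, all in `S`, then their average degree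
is at most `r * #E / #S`, so some point of `S` lies in at most `d` of them as soon as
`r * #E < (d + 1) * #S`. Deleting that point, and `d` sets containing all those through it,
leaves a smaller family of the same kind. -/
lemma exists_delete_vertex (hT : ∀ i, (T i).card ≤ r) {S : Finset α} {E : Finset ι}
    (hES : ∀ i ∈ E, T i ⊆ S) {d : ℕ} (hlt : r * E.card < (d + 1) * S.card) (hd : d ≤ E.card) :
    ∃ (S' : Finset α) (E' : Finset ι), S'.card + 1 = S.card ∧ E'.card + d = E.card ∧
      ∀ i ∈ E', T i ⊆ S' := by
  classical
  obtain ⟨v, hv, hdeg⟩ : ∃ v ∈ S, (E.filter fun i => v ∈ T i).card ≤ d := by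
    by_contra! h
    have h1 : (d + 1) * S.card ≤ ∑ v ∈ S, (E.filter fun i => v ∈ T i).card := by
      rw [mul_comm, ← smul_eq_mul]
      exact Finset.card_nsmul_le_sum _ _ _ fun v hv => h v hv
    have h2 : ∑ v ∈ S, (E.filter fun i => v ∈ T i).card ≤ r * E.card := by
      simp_rw [Finset.card_filter]
      rw [Finset.sum_comm, mul_comm, ← smul_eq_mul]
      refine Finset.sum_le_card_nsmul _ _ _ fun i _ => ?_
      rw [← Finset.card_filter]
      exact (Finset.card_le_card fun x hx => (Finset.mem_filter.1 hx).2).trans (hT i)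
    omega
  have hcard := Finset.card_filter_add_card_filter_not (s := E) (fun i => v ∈ T i)
  obtain ⟨E', hE', hE'card⟩ :=
    Finset.exists_subset_card_eq (s := E.filter fun i => ¬ v ∈ T i) (n := E.card - d) (by omega)
  refine ⟨S.erase v, E', Finset.card_erase_add_one hv, by omega, fun i hi x hx => ?_⟩
  obtain ⟨hiE, hiv⟩ := Finset.mem_filter.1 (hE' hi)
  exact Finset.mem_erase.2 ⟨fun h => hiv (h ▸ hx), hES i hiE hx⟩

/-- Deletions of cost `2`: with `K` sets of at most three points in a `K`-point set, the average
degree is at most `3`, and it is less than `3` from the second deletion on. -/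
lemma exists_sparse_of_two_per_deletion {K : ℕ} {T : Fin K → Finset (Fin K)}
    (hT : ∀ i, (T i).card ≤ 3) (k : ℕ) (hk : 2 * (k + 1) + 1 ≤ K) :
    ∃ (S : Finset (Fin K)) (E : Finset (Fin K)), S.card + (k + 1) = K ∧
      E.card + (2 * (k + 1) + 1) = K ∧ ∀ i ∈ E, T i ⊆ S := by
  induction k with
  | zero =>
    obtain ⟨S, E, h1, h2, h3⟩ := exists_delete_vertex (S := Finset.univ) (E := Finset.univ) hT
      (by simp) (d := 3) (by simp; omega) (by simp; omega)
    simp only [Finset.card_univ, Fintype.card_fin] at h1 h2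
    exact ⟨S, E, by omega, by omega, h3⟩
  | succ k ih =>
    obtain ⟨S, E, h1, h2, h3⟩ := ih (by omega)
    obtain ⟨S', E', h1', h2', h3'⟩ := exists_delete_vertex (d := 2) hT h3 (by omega) (by omega)
    exact ⟨S', E', by omega, by omega, h3'⟩

/-- Deletions of cost `1`, possible once a quarter of the points is gone and the average degree
has fallen below `2`. -/
lemma exists_sparse_of_one_per_deletion {K : ℕ} {T : Fin K → Finset (Fin K)}
    (hT : ∀ i, (T i).card ≤ 3) (k l : ℕ) (hk : K ≤ 4 * (k + 1)) (hl : 2 * (k + 1) + 1 + l ≤ K) :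
    ∃ (S : Finset (Fin K)) (E : Finset (Fin K)), S.card + (k + 1 + l) = K ∧
      E.card + (2 * (k + 1) + 1 + l) = K ∧ ∀ i ∈ E, T i ⊆ S := by
  induction l with
  | zero => exact exists_sparse_of_two_per_deletion hT k (by omega)
  | succ l ih =>
    obtain ⟨S, E, h1, h2, h3⟩ := ih (by omega)
    obtain ⟨S', E', h1', h2', h3'⟩ := exists_delete_vertex (d := 1) hT h3 (by omega) (by omega)
    exact ⟨S', E', by omega, by omega, h3'⟩

/-- With at most three transmitters per message there are about `5 K / 8` receivers `A` such that
all the other messages live on a set `V` of only `#A` transmitters. -/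
lemma exists_receivers_card_eq {K : ℕ} (hK : 16 ≤ K) {T : Fin K → Finset (Fin K)}
    (hT : ∀ i, (T i).card ≤ 3) :
    ∃ A V : Finset (Fin K), V.card = A.card ∧ A.card = 5 * (K / 8) + 5 ∧
      ∀ i, i ∉ A → T i ⊆ V := by
  -- `2 (K / 8) + 2` deletions reach average degree below `2`; `K / 8` more reach `#E + #S ≤ K`.
  obtain ⟨S, E, hS, hE, hES⟩ :=
    exists_sparse_of_one_per_deletion hT (2 * (K / 8) + 1) (K / 8) (by omega) (by omega)
  obtain ⟨V, hSV, -, hV⟩ := Finset.exists_subsuperset_card_eq (Finset.subset_univ S)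
    (n := 5 * (K / 8) + 5) (by omega) (by simp; omega)
  have hA : (Eᶜ).card = 5 * (K / 8) + 5 := by
    rw [Finset.card_compl, Fintype.card_fin]; omega
  exact ⟨Eᶜ, V, by rw [hV, hA], hA, fun i hi => (hES i (by simpa using hi)).trans hSV⟩

end Combinatorics

/-! ### Invertibility of random matrices -/

section Genericity

/-- A Fubini argument: a set is null for a finite product measure if all its sections along one
coordinate are null. -/
lemma pi_eq_zero_of_section {ι : Type*} [Fintype ι] [DecidableEq ι] {X : ι → Type*}
    [∀ i, MeasurableSpace (X i)] (ν : ∀ i, Measure (X i)) [∀ i, SigmaFinite (ν i)]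
    {s : Set (∀ i, X i)} (hs : MeasurableSet s) (a : ι)
    (h : ∀ x, ν a {r | Function.update x a r ∈ s} = 0) : Measure.pi ν s = 0 := by
  rcases isEmpty_or_nonempty (∀ i, X i) with he | ⟨⟨x₀⟩⟩
  · rw [Set.eq_empty_of_isEmpty s, measure_empty]
  have hm : Measurable (s.indicator (1 : (∀ i, X i) → ℝ≥0∞)) := measurable_one.indicator hs
  rw [← lintegral_indicator_one hs, lintegral_eq_lmarginal_univ x₀,
    lmarginal_erase' (μ := ν) _ hm (Finset.mem_univ a)]
  have : (fun x => ∫⁻ r, s.indicator (1 : (∀ i, X i) → ℝ≥0∞) (Function.update x a r) ∂ν a)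
      = fun _ => 0 := by
    funext x
    have hsec : MeasurableSet {r | Function.update x a r ∈ s} := measurable_update x hs
    rw [← h x, ← lintegral_indicator_one hsec]
    rfl
  rw [this]
  simp [lmarginal]

/-- A nonzero linear form vanishes with probability zero at independent atomless coefficients. -/
lemma pi_linearForm_eq_zero {ι κ : Type*} [Fintype ι] [DecidableEq ι] [Fintype κ]
    (μ : Measure ℂ) [IsProbabilityMeasure μ] [NullSingletonClass μ] {f : κ → ι}
    (hf : Function.Injective f) {b : κ → ℂ} {k : κ} (hb : b k ≠ 0) :
    Measure.pi (fun _ : ι => μ) {r | ∑ q, r (f q) * b q = 0} = 0 := by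
  classical
  refine pi_eq_zero_of_section _ ?_ (f k) fun x => ?_
  · exact measurableSet_eq_fun (by fun_prop) measurable_const
  · refine measure_mono_null (t := {-(∑ q ∈ Finset.univ.erase k, x (f q) * b q) / b k}) ?_
      (measure_singleton _)
    intro r hr
    simp only [Set.mem_ofPred_eq] at hr
    rw [← Finset.add_sum_erase _ _ (Finset.mem_univ k), Function.update_self,
      Finset.sum_congr rfl (g := fun q => x (f q) * b q)] at hr
    · rw [Set.mem_singleton_iff, eq_div_iff hb]
      linear_combination hr
    · intro q hq
      rw [Function.update_of_ne (fun h => Finset.ne_of_mem_erase hq (hf h))]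

/-- Square submatrices of a matrix of independent atomless coefficients are almost surely
invertible. By Laplace expansion along the first row, the determinant is a linear form in that row
whose first coefficient is a smaller minor in the other rows. -/
lemma ae_det_ne_zero (μ : Measure ℂ) [IsProbabilityMeasure μ] [NullSingletonClass μ] {K m : ℕ}
    {e f : Fin m → Fin K} (he : Function.Injective e) (hf : Function.Injective f) :
    ∀ᵐ H ∂coeffLaw μ K, (Matrix.of fun p q => H (e p) (f q)).det ≠ 0 := by
  induction m with
  | zero => simp
  | succ m ih =>
    have key : coeffLaw μ K {H | (Matrix.of fun p q => H (e p) (f q)).det = 0 ∧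
        (Matrix.of fun p q => H (e (Fin.succ p)) (f (Fin.succ q))).det ≠ 0} = 0 := by
      refine pi_eq_zero_of_section _ ?_ (e 0) fun x => ?_
      · have h1 : Measurable fun H : Fin K → Fin K → ℂ =>
            (Matrix.of fun p q => H (e p) (f q)).det :=
          (Continuous.matrix_det (continuous_matrix fun i j => by
            simp only [Matrix.of_apply]; fun_prop)).measurable
        have h2 : Measurable fun H : Fin K → Fin K → ℂ =>
            (Matrix.of fun p q => H (e (Fin.succ p)) (f (Fin.succ q))).det :=
          (Continuous.matrix_det (continuous_matrix fun i j => by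
            simp only [Matrix.of_apply]; fun_prop)).measurable
        exact (measurableSet_eq_fun h1 measurable_const).inter
          (measurableSet_eq_fun h2 measurable_const).compl
      · have hup : ∀ (r : Fin K → ℂ) (p : Fin m),
            Function.update x (e 0) r (e (Fin.succ p)) = x (e (Fin.succ p)) := fun r p =>
          Function.update_of_ne (fun h => Fin.succ_ne_zero p (he h)) _ _
        by_cases hx : (Matrix.of fun p q => x (e (Fin.succ p)) (f (Fin.succ q))).det = 0
        · simp [hup, hx]
        · refine measure_mono_null ?_ (pi_linearForm_eq_zero μ hf (k := 0)
            (b := fun q => (-1) ^ (q : ℕ) *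
              (Matrix.of fun p p' => x (e (Fin.succ p)) (f (q.succAbove p'))).det)
            (by simpa using hx))
          intro r hr
          have := hr.1
          rw [Matrix.det_succ_row_zero] at this
          simp only [Set.mem_ofPred_eq]
          rw [← this]
          refine Finset.sum_congr rfl fun q _ => ?_
          have : (Matrix.of fun p q => Function.update x (e 0) r (e p) (f q)).submatrix
              Fin.succ q.succAbove =
                Matrix.of fun p p' => x (e (Fin.succ p)) (f (q.succAbove p')) := by
            ext p p'
            simp [hup]
          rw [this]
          simp only [Matrix.of_apply, Function.update_self]
          ring
    have h1 := measure_eq_zero_iff_ae_notMem.1 key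
    filter_upwards [h1, ih (he.comp (Fin.succ_injective m)) (hf.comp (Fin.succ_injective m))]
      with H hH hH' h0
    exact hH ⟨h0, hH'⟩

end Genericity

/-! ### Gaussian noise and Gaussian integrals -/

section NoiseAndVolume

lemma pi_le_pi {ι : Type*} [Fintype ι] {X : ι → Type*} [∀ i, MeasurableSpace (X i)]
    {μ ν : ∀ i, Measure (X i)} (h : ∀ i, μ i ≤ ν i) : Measure.pi μ ≤ Measure.pi ν := by
  refine Measure.le_iff.2 fun s hs => ?_
  simp only [Measure.pi, toMeasure_apply _ _ hs]
  refine (OuterMeasure.le_pi.2 fun t _ => ?_ :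
    OuterMeasure.pi (fun i => (μ i).toOuterMeasure) ≤
      OuterMeasure.pi fun i => (ν i).toOuterMeasure) s
  exact (OuterMeasure.pi_pi_le _ _).trans (Finset.prod_le_prod' fun i _ => h i (t i))

lemma gaussianReal_half_le_volume : gaussianReal 0 (1 / 2) ≤ volume := by
  rw [gaussianReal_of_var_ne_zero _ (by norm_num)]
  conv_rhs => rw [← withDensity_one (μ := (volume : Measure ℝ))]
  refine withDensity_mono (ae_of_all _ fun x => ?_)
  rw [gaussianPDF, Pi.one_apply, ENNReal.ofReal_le_one, gaussianPDFReal]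
  have h1 : (1 : ℝ) ≤ √(2 * Real.pi * ((1 / 2 : ℝ≥0) : ℝ)) := by
    rw [Real.one_le_sqrt]
    push_cast
    nlinarith [Real.pi_gt_three]
  refine mul_le_one₀ (inv_le_one_of_one_le₀ h1) (Real.exp_nonneg _) (Real.exp_le_one_iff.2 ?_)
  rw [neg_div]
  exact neg_nonpos.2 (by positivity)

instance : IsProbabilityMeasure stdComplexGaussian :=
  Measure.isProbabilityMeasure_map Complex.measurableEquivRealProd.symm.measurable.aemeasurable

/-- The density of the standard complex Gaussian law is at most `1`. -/
lemma stdComplexGaussian_le_volume : stdComplexGaussian ≤ volume := by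
  rw [stdComplexGaussian, ← Complex.volume_preserving_equiv_real_prod.symm.map_eq]
  refine Measure.map_mono ?_ Complex.measurableEquivRealProd.symm.measurable
  exact Measure.prod_mono gaussianReal_half_le_volume gaussianReal_half_le_volume

lemma lintegral_sq_gaussianReal_half :
    ∫⁻ x, ENNReal.ofReal (x ^ 2) ∂gaussianReal 0 (1 / 2) = 1 / 2 := by
  have h := variance_id_gaussianReal (μ := 0) (v := 1 / 2)
  have hi := (memLp_id_gaussianReal (μ := 0) (v := 1 / 2) 2).integrable_sq
  rw [variance_of_integral_eq_zero aemeasurable_id (by simp)] at h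
  have h' := ofReal_integral_eq_lintegral_ofReal hi (ae_of_all _ fun x => sq_nonneg _)
  simp only [id] at h h'
  rw [← h', h]
  simp

lemma lintegral_norm_sq_stdComplexGaussian :
    ∫⁻ z, ENNReal.ofReal (‖z‖ ^ 2) ∂stdComplexGaussian = 1 := by
  have h : ∀ p : ℝ × ℝ, ENNReal.ofReal (‖Complex.measurableEquivRealProd.symm p‖ ^ 2) =
      ENNReal.ofReal (p.1 ^ 2) + ENNReal.ofReal (p.2 ^ 2) := by
    intro p
    rw [← ENNReal.ofReal_add (sq_nonneg _) (sq_nonneg _), ← Complex.normSq_eq_norm_sq,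
      Complex.normSq_apply]
    simp [Complex.measurableEquivRealProd, sq]
  rw [stdComplexGaussian, lintegral_map_equiv]
  simp_rw [h]
  rw [lintegral_add_left (by fun_prop), lintegral_prod _ (by fun_prop),
    lintegral_prod_symm _ (by fun_prop)]
  simp only [lintegral_const, measure_univ, mul_one, lintegral_sq_gaussianReal_half]
  exact ENNReal.add_halves 1

lemma lintegral_exp_neg_norm_sq_div {v : ℝ} (hv : 0 < v) :
    ∫⁻ z : ℂ, ENNReal.ofReal (Real.exp (-(‖z‖ ^ 2 / v))) = ENNReal.ofReal (Real.pi * v) := by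
  have h := GaussianFourier.integral_rexp_neg_mul_sq_norm (V := ℂ) (b := v⁻¹) (by positivity)
  have hfun : (fun z : ℂ => Real.exp (-(‖z‖ ^ 2 / v))) =
      fun z : ℂ => Real.exp (-v⁻¹ * ‖z‖ ^ 2) := by
    funext z; congr 1; field_simp
  have hpos : 0 < Real.pi * v := by positivity
  have hval : ∫ z : ℂ, Real.exp (-(‖z‖ ^ 2 / v)) = Real.pi * v := by
    rw [hfun, h]
    simp [Complex.finrank_real_complex]
  rw [← ofReal_integral_eq_lintegral_ofReal _ (ae_of_all _ fun z => (Real.exp_pos _).le), hval]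
  by_contra hn
  rw [integral_undef hn] at hval
  exact hpos.ne hval

/-- The law of the noise at all receivers, taken independent across receivers: only the marginal
laws enter the error probabilities, so this coupling may be chosen freely. -/
def jointNoise (K n : ℕ) : Measure (Fin K → Fin n → ℂ) := Measure.pi fun _ => noiseLaw n

instance (n : ℕ) : IsProbabilityMeasure (noiseLaw n) := by unfold noiseLaw; infer_instance

instance (K n : ℕ) : IsProbabilityMeasure (jointNoise K n) := by unfold jointNoise; infer_instance

lemma jointNoise_le_volume (K n : ℕ) : jointNoise K n ≤ volume :=
  pi_le_pi fun _ => pi_le_pi fun _ => stdComplexGaussian_le_volume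

lemma measurePreserving_eval_jointNoise {K n : ℕ} (i : Fin K) :
    MeasurePreserving (Function.eval i) (jointNoise K n) (noiseLaw n) :=
  measurePreserving_eval (fun _ => noiseLaw n) i

lemma measurePreserving_eval_noiseLaw {n : ℕ} (t : Fin n) :
    MeasurePreserving (Function.eval t) (noiseLaw n) stdComplexGaussian :=
  measurePreserving_eval (fun _ => stdComplexGaussian) t

/-- By Markov's inequality, the noise has energy at most eight times its mean with probability
at least `7 / 8`. -/
lemma jointNoise_energy_gt {K n : ℕ} (hK : 0 < K) (hn : 0 < n) :
    jointNoise K n {z | (8 * n * K : ℝ) < ∑ t, ∑ i, ‖z i t‖ ^ 2} ≤ ENNReal.ofReal (1 / 8) := by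
  have hmean : ∫⁻ z, ENNReal.ofReal (∑ t, ∑ i, ‖z i t‖ ^ 2) ∂jointNoise K n =
      ENNReal.ofReal (n * K) := by
    have h1 : ∀ (i : Fin K) (t : Fin n),
        ∫⁻ z, ENNReal.ofReal (‖z i t‖ ^ 2) ∂jointNoise K n = 1 := by
      intro i t
      rw [← lintegral_norm_sq_stdComplexGaussian]
      exact ((measurePreserving_eval_noiseLaw t).comp
        (measurePreserving_eval_jointNoise i)).lintegral_comp
          (f := fun z => ENNReal.ofReal (‖z‖ ^ 2)) (by fun_prop)
    have h2 : ∀ z : Fin K → Fin n → ℂ, ENNReal.ofReal (∑ t, ∑ i, ‖z i t‖ ^ 2) =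
        ∑ t, ∑ i, ENNReal.ofReal (‖z i t‖ ^ 2) := by
      intro z
      rw [ENNReal.ofReal_sum_of_nonneg fun t _ => by positivity]
      exact Finset.sum_congr rfl fun t _ =>
        ENNReal.ofReal_sum_of_nonneg fun i _ => by positivity
    simp_rw [h2]
    rw [lintegral_finsetSum _ fun t _ => by fun_prop]
    have h3 : ∀ t, ∫⁻ z, ∑ i, ENNReal.ofReal (‖z i t‖ ^ 2) ∂jointNoise K n = K := by
      intro t
      rw [lintegral_finsetSum _ fun i _ => by fun_prop]
      simp only [h1, Finset.sum_const, Finset.card_univ, Fintype.card_fin, nsmul_eq_mul, mul_one]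
    simp only [h3, Finset.sum_const, Finset.card_univ, Fintype.card_fin, nsmul_eq_mul]
    rw [ENNReal.ofReal_mul (Nat.cast_nonneg n), ENNReal.ofReal_natCast, ENNReal.ofReal_natCast]
  have hpos : (0 : ℝ) < 8 * n * K := by positivity
  calc _ ≤ jointNoise K n {z | ENNReal.ofReal (8 * n * K) ≤
          ENNReal.ofReal (∑ t, ∑ i, ‖z i t‖ ^ 2)} :=
        measure_mono fun z hz => ENNReal.ofReal_le_ofReal (le_of_lt hz)
    _ ≤ ENNReal.ofReal (n * K) / ENNReal.ofReal (8 * n * K) := by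
        rw [← hmean]
        refine meas_ge_le_lintegral_div ?_ (ENNReal.ofReal_pos.2 hpos).ne' ENNReal.ofReal_ne_top
        exact Measurable.aemeasurable (by fun_prop)
    _ = ENNReal.ofReal (1 / 8) := by
        rw [← ENNReal.ofReal_div_of_pos hpos]
        congr 1
        field_simp

/-- Tonelli's theorem for products of functions of one coordinate each. -/
lemma lintegral_pi_prod_eq_prod {ι : Type*} [Fintype ι] {X : ι → Type*}
    [∀ i, MeasurableSpace (X i)] (μ : ∀ i, Measure (X i)) [∀ i, SigmaFinite (μ i)]
    {f : ∀ i, X i → ℝ≥0∞} (hf : ∀ i, Measurable (f i)) :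
    ∫⁻ x, ∏ i, f i (x i) ∂Measure.pi μ = ∏ i, ∫⁻ x, f i x ∂μ i := by
  classical
  rcases isEmpty_or_nonempty (∀ i, X i) with he | ⟨⟨x₀⟩⟩
  · obtain ⟨i, hi⟩ := not_forall.1 fun h : ∀ i, Nonempty (X i) =>
      he.elim fun i => (h i).some
    have := not_nonempty_iff.1 hi
    rw [lintegral_of_isEmpty]
    exact (Finset.prod_eq_zero (Finset.mem_univ i) (lintegral_of_isEmpty _ _)).symm
  · rw [lintegral_eq_lmarginal_univ x₀]
    suffices h : ∀ (s : Finset ι) (x : ∀ i, X i),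
        (∫⋯∫⁻_s, (fun x => ∏ i ∈ s, f i (x i)) ∂μ) x = ∏ i ∈ s, ∫⁻ x, f i x ∂μ i from h _ _
    intro s
    induction s using Finset.induction_on with
    | empty => simp
    | insert i s hi ih =>
      intro x
      have hm : ∀ s : Finset ι, Measurable fun x : ∀ i, X i => ∏ i ∈ s, f i (x i) :=
        fun s => by fun_prop
      rw [lmarginal_insert _ (hm _) hi, Finset.prod_insert hi,
        ← lintegral_mul_const _ (hf i)]
      refine lintegral_congr fun r => ?_
      rw [← ih (Function.update x i r)]
      simp only [lmarginal, Finset.prod_insert hi]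
      have hr : ∀ y, Function.updateFinset (Function.update x i r) s y i = r := fun y => by
        simp [Function.updateFinset, hi]
      simp only [hr]
      exact lintegral_const_mul _ ((hm s).comp measurable_updateFinset)

/-- An integral after a shear: if the coordinates outside `p` are shifted by functions of the
coordinates in `p`, the integral does not change. -/
lemma lintegral_prod_sub_shear {ι X : Type*} [Fintype ι]
    [AddGroup X] [MeasureSpace X] [SigmaFinite (volume : Measure X)]
    [MeasurableAdd₂ X] [MeasurableNeg X] [(volume : Measure X).IsAddRightInvariant]
    (p : ι → Prop) [DecidablePred p] {φ : (ι → X) → ι → X} (hφ : Measurable φ)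
    (hφp : ∀ y i, p i → φ y i = 0) (hφdep : ∀ y y', (∀ i, p i → y i = y' i) → φ y = φ y')
    {f : ι → X → ℝ≥0∞} (hf : ∀ i, Measurable (f i)) :
    ∫⁻ y : ι → X, ∏ i, f i (y i - φ y i) = ∏ i, ∫⁻ x, f i x := by
  have hm : Measurable fun y : ι → X => ∏ i, f i (y i - φ y i) := by fun_prop
  have e := (volume_preserving_piEquivPiSubtypeProd (fun _ : ι => X) p).symm
  rw [← e.lintegral_comp_emb (MeasurableEquiv.measurableEmbedding _)]
  rw [Measure.volume_eq_prod, lintegral_prod _ (by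
    exact (hm.comp e.measurable).aemeasurable)]
  have hglue1 : ∀ (a : {i // p i} → X) (b : {i // ¬p i} → X) (i : {i // p i}),
      (MeasurableEquiv.piEquivPiSubtypeProd (fun _ : ι => X) p).symm (a, b) i = a i := by
    intro a b i
    simp [MeasurableEquiv.piEquivPiSubtypeProd, Equiv.piEquivPiSubtypeProd, i.2]
  have hglue2 : ∀ (a : {i // p i} → X) (b : {i // ¬p i} → X) (i : {i // ¬p i}),
      (MeasurableEquiv.piEquivPiSubtypeProd (fun _ : ι => X) p).symm (a, b) i = b i := by
    intro a b i
    simp [MeasurableEquiv.piEquivPiSubtypeProd, Equiv.piEquivPiSubtypeProd, i.2]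
  generalize (MeasurableEquiv.piEquivPiSubtypeProd (fun _ : ι => X) p).symm = g at *
  have hinner : ∀ a : {i // p i} → X,
      ∫⁻ b : {i // ¬p i} → X, ∏ i, f i (g (a, b) i - φ (g (a, b)) i) =
        (∏ i : {i // p i}, f i (a i)) * ∏ i : {i // ¬p i}, ∫⁻ x, f i x := by
    intro a
    have hψ : ∀ b, φ (g (a, b)) = φ (g (a, 0)) := fun b => hφdep _ _ fun i hi => by
      rw [hglue1 a b ⟨i, hi⟩, hglue1 a 0 ⟨i, hi⟩]
    have h1 : ∀ b : {i // ¬p i} → X, ∏ i, f i (g (a, b) i - φ (g (a, b)) i) =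
        (∏ i : {i // p i}, f i (a i)) *
          ∏ i : {i // ¬p i}, f i (b i - φ (g (a, 0)) i) := by
      intro b
      rw [← Fintype.prod_subtype_mul_prod_subtype p, hψ b]
      congr 1
      · exact Finset.prod_congr rfl fun i _ => by rw [hglue1, hφp _ _ i.2, sub_zero]
      · exact Finset.prod_congr rfl fun i _ => by rw [hglue2]
    simp_rw [h1]
    rw [lintegral_const_mul _ (by fun_prop)]
    congr 1
    rw [volume_pi, lintegral_pi_prod_eq_prod (fun _ => volume)
      (f := fun (i : {i // ¬p i}) x => f i (x - φ (g (a, 0)) i)) fun i => by fun_prop]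
    exact Finset.prod_congr rfl fun i _ => lintegral_sub_right_eq_self (f i) _
  simp_rw [hinner]
  rw [lintegral_mul_const _ (by fun_prop), volume_pi,
    lintegral_pi_prod_eq_prod (fun _ => volume) (f := fun (i : {i // p i}) x => f i x)
      fun i => hf i,
    Fintype.prod_subtype_mul_prod_subtype p fun i => ∫⁻ x, f i x]

end NoiseAndVolume

/-! ### The packing bound for a fixed channel realization -/

section Converse

variable {K : ℕ}

/-- The total squared gain of a channel matrix. -/
def gain (M : Fin K → Fin K → ℂ) : ℝ := ∑ i, ∑ j, ‖M i j‖ ^ 2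

/-- `L` predicts all outputs from the outputs in `A`, as far as the inputs in `V` are concerned:
the columns `V` of the channel matrix `M` satisfy `M = L M_A`. -/
def IsPredictor (A V : Finset (Fin K)) (M L : Fin K → Fin K → ℂ) : Prop :=
  ∀ b, ∀ j ∈ V, M b j = ∑ a ∈ A, L b a * M a j

lemma gain_nonneg (M : Fin K → Fin K → ℂ) : 0 ≤ gain M := by unfold gain; positivity

lemma sum_row_le_gain (M : Fin K → Fin K → ℂ) (s : Finset (Fin K)) (i : Fin K) :
    ∑ j ∈ s, ‖M i j‖ ^ 2 ≤ gain M :=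
  (Finset.sum_le_univ_sum_of_nonneg fun j => by positivity).trans
    (Finset.single_le_sum (f := fun i => ∑ j, ‖M i j‖ ^ 2) (fun i _ => by positivity)
      (Finset.mem_univ i))

lemma norm_sum_mul_sq_le {ι : Type*} (s : Finset ι) (f g : ι → ℂ) :
    ‖∑ a ∈ s, f a * g a‖ ^ 2 ≤ (∑ a ∈ s, ‖f a‖ ^ 2) * ∑ a ∈ s, ‖g a‖ ^ 2 := by
  refine le_trans ?_ (Finset.sum_mul_sq_le_sq_mul_sq s (fun a => ‖f a‖) fun a => ‖g a‖)
  gcongr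
  exact (norm_sum_le _ _).trans_eq (Finset.sum_congr rfl fun a _ => norm_mul _ _)

lemma norm_add_sq_le_two_mul (a b : ℂ) : ‖a + b‖ ^ 2 ≤ 2 * ‖a‖ ^ 2 + 2 * ‖b‖ ^ 2 := by
  have := pow_le_pow_left₀ (norm_nonneg _) (norm_add_le a b) 2
  nlinarith [sq_nonneg (‖a‖ - ‖b‖)]

variable {T : Fin K → Finset (Fin K)} {n : ℕ}

namespace Code

/-- What the receivers in `A` know about the messages: their own decisions, and a dummy value for
the messages of the other receivers. -/
def partialDecision (c : Code T n) (A : Finset (Fin K)) (y : Fin K → Fin n → ℂ)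
    (i : Fin K) : Fin (c.size i) :=
  if i ∈ A then c.dec i (y i) else ⟨0, c.size_pos i⟩

/-- The prediction of the outputs outside `A` from the outputs in `A`, in the time slots `good`
where the predictor `L` is usable. The decisions of the receivers in `A` determine the inputs
outside `V`; after subtracting their contribution, the outputs in `A` determine the others up to
noise. The prediction is `0` elsewhere. -/
def prediction (c : Code T n) (H L : Realization K) (A V : Finset (Fin K)) (good : Finset (Fin n))
    (y : Fin K → Fin n → ℂ) (i : Fin K) (t : Fin n) : ℂ :=
  if i ∈ A ∨ t ∉ good then 0 else
    ∑ j ∈ Vᶜ, H t i j * c.enc j (c.partialDecision A y) t +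
      ∑ a ∈ A, L t i a * (y a t - ∑ j ∈ Vᶜ, H t a j * c.enc j (c.partialDecision A y) t)

lemma measurable_prediction (c : Code T n) (H L : Realization K) (A V : Finset (Fin K))
    (good : Finset (Fin n)) : Measurable (c.prediction H L A V good) := by
  have h1 : Measurable (c.partialDecision A) := by
    refine measurable_pi_lambda _ fun i => ?_
    unfold partialDecision
    split_ifs
    · exact (c.measurable_dec i).comp (measurable_pi_apply i)
    · exact measurable_const
  have h2 : ∀ j t, Measurable fun y => c.enc j (c.partialDecision A y) t := fun j t =>
    (Measurable.of_discrete (f := fun w => c.enc j w t)).comp h1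
  refine measurable_pi_lambda _ fun i => measurable_pi_lambda _ fun t => ?_
  unfold prediction
  split_ifs <;> fun_prop

lemma prediction_eq_zero (c : Code T n) (H L : Realization K) {A : Finset (Fin K)}
    (V : Finset (Fin K)) (good : Finset (Fin n)) (y : Fin K → Fin n → ℂ) {i : Fin K}
    (hi : i ∈ A) : c.prediction H L A V good y i = 0 := by
  funext t
  simp [prediction, hi]

lemma prediction_congr (c : Code T n) (H L : Realization K) {A : Finset (Fin K)}
    (V : Finset (Fin K)) (good : Finset (Fin n)) {y y' : Fin K → Fin n → ℂ}
    (h : ∀ i ∈ A, y i = y' i) :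
    c.prediction H L A V good y = c.prediction H L A V good y' := by
  have h1 : c.partialDecision A y = c.partialDecision A y' := by
    funext i
    unfold partialDecision
    split_ifs with hi
    · rw [h i hi]
    · rfl
  funext i t
  unfold prediction
  rw [h1]
  split_ifs with hi
  · rfl
  · congr 1
    exact Finset.sum_congr rfl fun a ha => by rw [h a ha]

/-- If all decisions are correct, then the predictions are off by noise only. -/
lemma sub_prediction (c : Code T n) {H L : Realization K} {A V : Finset (Fin K)}
    (hT : ∀ i, i ∉ A → T i ⊆ V) {good : Finset (Fin n)}
    {w : (i : Fin K) → Fin (c.size i)} {y z : Fin K → Fin n → ℂ}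
    (hy : ∀ i t, y i t = c.signal H i w t + z i t) (hdec : ∀ i, c.dec i (y i) = w i)
    {i : Fin K} (hi : i ∉ A) {t : Fin n} (ht : t ∈ good) (hL : IsPredictor A V (H t) (L t)) :
    y i t - c.prediction H L A V good y i t = z i t - ∑ a ∈ A, L t i a * z a t := by
  have hx : ∀ j ∈ Vᶜ, c.enc j (c.partialDecision A y) = c.enc j w := by
    intro j hj
    refine c.enc_local j _ _ fun k hk => ?_
    by_cases hkA : k ∈ A
    · simp [partialDecision, hkA, hdec]
    · exact absurd (hT k hkA hk) (Finset.mem_compl.1 hj)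
  have hsum : ∀ k, ∑ j ∈ Vᶜ, H t k j * c.enc j (c.partialDecision A y) t =
      ∑ j ∈ Vᶜ, H t k j * c.enc j w t := fun k =>
    Finset.sum_congr rfl fun j hj => by rw [hx j hj]
  have hV : ∀ k, y k t - ∑ j ∈ Vᶜ, H t k j * c.enc j w t =
      ∑ j ∈ V, H t k j * c.enc j w t + z k t := by
    intro k
    rw [hy, signal, ← Finset.sum_add_sum_compl V]
    ring
  have hswap : ∑ j ∈ V, H t i j * c.enc j w t =
      ∑ a ∈ A, L t i a * ∑ j ∈ V, H t a j * c.enc j w t := by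
    simp_rw [Finset.mul_sum]
    rw [Finset.sum_comm]
    refine Finset.sum_congr rfl fun j hj => ?_
    rw [hL i j hj, Finset.sum_mul]
    exact Finset.sum_congr rfl fun a _ => by ring
  have hcond : ¬(i ∈ A ∨ t ∉ good) := by simp [hi, ht]
  rw [prediction, if_neg hcond, hsum, ← sub_sub, hV i, hswap]
  simp_rw [hsum, hV, mul_add, Finset.sum_add_distrib]
  ring

/-- The scale of the error of the prediction: the power of the output where nothing is predicted,
and the power of the predicted noise elsewhere. -/
def scale (H : Realization K) (A : Finset (Fin K)) (good : Finset (Fin n)) (P m : ℝ)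
    (i : Fin K) (t : Fin n) : ℝ :=
  if i ∈ A ∨ t ∉ good then (1 + gain (H t)) * (1 + P) else 1 + m

lemma scale_pos (H : Realization K) (A : Finset (Fin K)) (good : Finset (Fin n)) {P m : ℝ}
    (hP : 0 ≤ P) (hm : 0 ≤ m) (i : Fin K) (t : Fin n) : 0 < scale H A good P m i t := by
  have := gain_nonneg (H t)
  unfold scale
  split_ifs <;> positivity

lemma norm_sub_prediction_sq_le (c : Code T n) {H L : Realization K} {A V : Finset (Fin K)}
    (hT : ∀ i, i ∉ A → T i ⊆ V) {good : Finset (Fin n)} {P m : ℝ} (hP : 0 ≤ P) (hm : 0 ≤ m)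
    (hL : ∀ t : Fin n, t ∈ good → IsPredictor A V (H t) (L t) ∧ gain (L t) ≤ m)
    {w : (i : Fin K) → Fin (c.size i)} {y z : Fin K → Fin n → ℂ}
    (hy : ∀ i t, y i t = c.signal H i w t + z i t) (hdec : ∀ i, c.dec i (y i) = w i)
    (i : Fin K) (t : Fin n) :
    ‖y i t - c.prediction H L A V good y i t‖ ^ 2 / scale H A good P m i t ≤
      2 * ((∑ j, ‖c.enc j w t‖ ^ 2) / (1 + P)) + 2 * ∑ k, ‖z k t‖ ^ 2 := by
  have hg := gain_nonneg (H t)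
  have hz : ‖z i t‖ ^ 2 ≤ ∑ k, ‖z k t‖ ^ 2 :=
    Finset.single_le_sum (f := fun k => ‖z k t‖ ^ 2) (fun k _ => by positivity)
      (Finset.mem_univ i)
  have hx : 0 ≤ ∑ j, ‖c.enc j w t‖ ^ 2 := by positivity
  have hz0 : 0 ≤ ∑ k, ‖z k t‖ ^ 2 := by positivity
  rw [div_le_iff₀ (scale_pos H A good hP hm i t)]
  by_cases hcond : i ∈ A ∨ t ∉ good
  · rw [prediction, if_pos hcond, scale, if_pos hcond, sub_zero, hy]
    have h1 : ‖c.signal H i w t‖ ^ 2 ≤ gain (H t) * ∑ j, ‖c.enc j w t‖ ^ 2 :=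
      (norm_sum_mul_sq_le _ _ _).trans
        (mul_le_mul_of_nonneg_right (sum_row_le_gain _ _ i) hx)
    have h2 : (2 * ((∑ j, ‖c.enc j w t‖ ^ 2) / (1 + P)) + 2 * ∑ k, ‖z k t‖ ^ 2) *
        ((1 + gain (H t)) * (1 + P)) = 2 * (∑ j, ‖c.enc j w t‖ ^ 2) * (1 + gain (H t)) +
          2 * (∑ k, ‖z k t‖ ^ 2) * ((1 + gain (H t)) * (1 + P)) := by
      field_simp
    have h3 : (1 : ℝ) ≤ (1 + gain (H t)) * (1 + P) := by nlinarith
    rw [h2]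
    nlinarith [norm_add_sq_le_two_mul (c.signal H i w t) (z i t),
      mul_le_mul_of_nonneg_left h3 hz0]
  · have hi : i ∉ A := fun h => hcond (Or.inl h)
    have ht : t ∈ good := by by_contra h; exact hcond (Or.inr h)
    rw [c.sub_prediction hT hy hdec hi ht (hL t ht).1, scale, if_neg hcond, sub_eq_add_neg]
    have h1 : ‖-∑ a ∈ A, L t i a * z a t‖ ^ 2 ≤ m * ∑ k, ‖z k t‖ ^ 2 := by
      rw [norm_neg]
      refine (norm_sum_mul_sq_le _ _ _).trans (mul_le_mul
        ((sum_row_le_gain _ _ i).trans (hL t ht).2)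
        (Finset.sum_le_univ_sum_of_nonneg fun j => by positivity) (by positivity) hm)
    have h2 : 0 ≤ (∑ j, ‖c.enc j w t‖ ^ 2) / (1 + P) * (1 + m) := by positivity
    nlinarith [norm_add_sq_le_two_mul (z i t) (-∑ a ∈ A, L t i a * z a t)]

/-- The volume of the set of outputs that are well predicted: the shear by the prediction preserves
volume, and Gaussian weights bound the volume of an ellipsoid. -/
lemma volume_prediction_le (c : Code T n) (H L : Realization K) (A V : Finset (Fin K))
    (good : Finset (Fin n)) {v : Fin K → Fin n → ℝ} (hv : ∀ i t, 0 < v i t) (ρ : ℝ) :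
    volume {y : Fin K → Fin n → ℂ |
        ∑ i, ∑ t, ‖y i t - c.prediction H L A V good y i t‖ ^ 2 / v i t ≤ ρ} ≤
      ENNReal.ofReal (Real.exp ρ * ∏ i, ∏ t, (Real.pi * v i t)) := by
  classical
  set f : Fin K → (Fin n → ℂ) → ℝ≥0∞ := fun i u =>
    ∏ t, ENNReal.ofReal (Real.exp (-(‖u t‖ ^ 2 / v i t))) with hf_def
  have hf : ∀ i, Measurable (f i) := fun i => by fun_prop
  have hφ := c.measurable_prediction H L A V good
  have hshear : ∫⁻ y : Fin K → Fin n → ℂ, ∏ i, f i (y i - c.prediction H L A V good y i) =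
      ENNReal.ofReal (∏ i, ∏ t, (Real.pi * v i t)) := by
    rw [lintegral_prod_sub_shear (· ∈ A) hφ
      (fun y i hi => c.prediction_eq_zero H L V good y hi)
      (fun y y' h => c.prediction_congr H L V good h) hf,
      ENNReal.ofReal_prod_of_nonneg fun i _ => Finset.prod_nonneg fun t _ =>
        (mul_pos Real.pi_pos (hv i t)).le]
    refine Finset.prod_congr rfl fun i _ => ?_
    rw [ENNReal.ofReal_prod_of_nonneg fun t _ => (mul_pos Real.pi_pos (hv i t)).le, hf_def,
      volume_pi, lintegral_pi_prod_eq_prod (fun _ => volume)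
        (f := fun t x => ENNReal.ofReal (Real.exp (-(‖x‖ ^ 2 / v i t)))) fun t => by fun_prop]
    exact Finset.prod_congr rfl fun t _ => lintegral_exp_neg_norm_sq_div (hv i t)
  have hexp : ∀ y : Fin K → Fin n → ℂ, ∏ i, f i (y i - c.prediction H L A V good y i) =
      ENNReal.ofReal (Real.exp
        (-∑ i, ∑ t, ‖y i t - c.prediction H L A V good y i t‖ ^ 2 / v i t)) := by
    intro y
    rw [← Finset.sum_neg_distrib, Real.exp_sum, ENNReal.ofReal_prod_of_nonneg fun i _ =>
      (Real.exp_pos _).le]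
    refine Finset.prod_congr rfl fun i _ => ?_
    rw [← Finset.sum_neg_distrib, Real.exp_sum, ENNReal.ofReal_prod_of_nonneg fun t _ =>
      (Real.exp_pos _).le]
    rfl
  have hmarkov := meas_ge_le_lintegral_div (μ := volume)
    (f := fun y : Fin K → Fin n → ℂ => ∏ i, f i (y i - c.prediction H L A V good y i))
    (by fun_prop : Measurable _).aemeasurable
    (ENNReal.ofReal_pos.2 (Real.exp_pos (-ρ))).ne' ENNReal.ofReal_ne_top
  rw [hshear, ← ENNReal.ofReal_div_of_pos (Real.exp_pos _)] at hmarkov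
  refine (measure_mono fun y hy => ?_).trans (hmarkov.trans_eq ?_)
  · change _ ≤ ∏ i, f i (y i - c.prediction H L A V good y i)
    rw [hexp]
    exact ENNReal.ofReal_le_ofReal (Real.exp_le_exp.2 (neg_le_neg hy))
  · rw [Real.exp_neg, div_inv_eq_mul, mul_comm]

/-- The events of receiving a well-predicted output and decoding it correctly are disjoint for
different messages, and the noise has density at most `1`; so the probabilities of these events
sum to at most the volume of the well-predicted outputs. -/
lemma sum_prob_le (c : Code T n) (H L : Realization K) (A V : Finset (Fin K))
    (good : Finset (Fin n)) {v : Fin K → Fin n → ℝ} (hv : ∀ i t, 0 < v i t) (ρ : ℝ) :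
    ∑ w, jointNoise K n {z | (∀ i, c.dec i (fun t => c.signal H i w t + z i t) = w i) ∧
        ∑ i, ∑ t, ‖(c.signal H i w t + z i t) - c.prediction H L A V good
          (fun i t => c.signal H i w t + z i t) i t‖ ^ 2 / v i t ≤ ρ} ≤
      ENNReal.ofReal (Real.exp ρ * ∏ i, ∏ t, (Real.pi * v i t)) := by
  set S : ((i : Fin K) → Fin (c.size i)) → Set (Fin K → Fin n → ℂ) := fun w =>
    {y : Fin K → Fin n → ℂ | (∀ i, c.dec i (y i) = w i) ∧
      ∑ i, ∑ t, ‖y i t - c.prediction H L A V good y i t‖ ^ 2 / v i t ≤ ρ}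
  have hφ := c.measurable_prediction H L A V good
  have hS : ∀ w, MeasurableSet (S w) := by
    intro w
    refine MeasurableSet.inter (s₁ := {y : Fin K → Fin n → ℂ | ∀ i, c.dec i (y i) = w i})
      (s₂ := {y : Fin K → Fin n → ℂ |
        ∑ i, ∑ t, ‖y i t - c.prediction H L A V good y i t‖ ^ 2 / v i t ≤ ρ}) ?_ ?_
    · have : {y : Fin K → Fin n → ℂ | ∀ i, c.dec i (y i) = w i} =
          ⋂ i, (fun y => c.dec i (y i)) ⁻¹' {w i} := by ext; simp
      rw [this]
      exact MeasurableSet.iInter fun i =>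
        ((c.measurable_dec i).comp (measurable_pi_apply i)) (measurableSet_singleton _)
    · have h1 : ∀ i t, Measurable fun y : Fin K → Fin n → ℂ =>
          c.prediction H L A V good y i t := fun i t =>
        (measurable_pi_apply t).comp ((measurable_pi_apply i).comp hφ)
      exact measurableSet_le (by fun_prop) measurable_const
  have hdisj : Pairwise (Function.onFun Disjoint S) := by
    intro w w' hne
    refine Set.disjoint_left.2 fun y hy hy' => hne ?_
    funext i
    rw [← hy.1 i, hy'.1 i]
  calc _ ≤ ∑ w, volume (S w) := by
        refine Finset.sum_le_sum fun w _ => (jointNoise_le_volume K n _).trans_eq ?_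
        exact measure_preimage_add volume (fun i t => c.signal H i w t) (S w)
    _ = volume (⋃ w, S w) := by rw [measure_iUnion hdisj hS, tsum_fintype]
    _ ≤ _ := (measure_mono (Set.iUnion_subset fun w y hy => hy.2)).trans
        (c.volume_prediction_le H L A V good hv ρ)

/-- The energy of the codewords of a message tuple. -/
def energy (c : Code T n) (w : (i : Fin K) → Fin (c.size i)) : ℝ := ∑ t, ∑ j, ‖c.enc j w t‖ ^ 2

lemma numMessages_pos (c : Code T n) : 0 < c.numMessages :=
  Finset.prod_pos fun i _ => c.size_pos i

lemma card_messages (c : Code T n) :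
    Fintype.card ((i : Fin K) → Fin (c.size i)) = c.numMessages := by
  simp [numMessages]

/-- By Markov's inequality, the energy exceeds four times its largest permitted mean for at most
a quarter of the messages. -/
lemma card_energy_gt_le (c : Code T n) {P : ℝ} (hP : 0 < P) (hK : 0 < K) (hn : 0 < n)
    (hpow : ∀ j, c.power j ≤ P) :
    ((Finset.univ.filter fun w => 4 * n * K * P < c.energy w).card : ℝ) ≤ c.numMessages / 4 := by
  have hN : (0 : ℝ) < c.numMessages := by exact_mod_cast c.numMessages_pos
  have hn' : (0 : ℝ) < n := by exact_mod_cast hn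
  have hK' : (0 : ℝ) < K := by exact_mod_cast hK
  have htot : ∑ w, c.energy w ≤ n * K * P * c.numMessages := by
    have h1 : ∀ j, ∑ w, ∑ t, ‖c.enc j w t‖ ^ 2 ≤ P * c.numMessages * n := by
      intro j
      have := hpow j
      rw [power, div_le_iff₀ hN, ← Finset.sum_div, div_le_iff₀ hn'] at this
      exact this
    have h2 : ∑ w, c.energy w = ∑ j, ∑ w, ∑ t, ‖c.enc j w t‖ ^ 2 := by
      rw [Finset.sum_comm]
      exact Finset.sum_congr rfl fun w _ => Finset.sum_comm
    rw [h2]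
    refine (Finset.sum_le_sum fun j _ => h1 j).trans_eq ?_
    simp
    ring
  have hE : ∀ w, 0 ≤ c.energy w := fun w => by unfold energy; positivity
  have hmark : (Finset.univ.filter fun w => 4 * n * K * P < c.energy w).card • (4 * n * K * P) ≤
      ∑ w, c.energy w :=
    (Finset.card_nsmul_le_sum _ _ _ fun w hw => (Finset.mem_filter.1 hw).2.le).trans
      (Finset.sum_le_univ_sum_of_nonneg hE)
  rw [nsmul_eq_mul] at hmark
  have hpos : 0 < n * K * P := by positivity
  nlinarith [hmark.trans htot]

lemma one_sub_le_prob_correct (c : Code T n) (H : Realization K) (hK : 0 < K) (hn : 0 < n)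
    (w : (i : Fin K) → Fin (c.size i)) :
    1 - 1 / 8 - ∑ i, (noiseLaw n).real {z | c.dec i (fun t => c.signal H i w t + z t) ≠ w i} ≤
      (jointNoise K n).real {z | (∀ i, c.dec i (fun t => c.signal H i w t + z i t) = w i) ∧
        ∑ t, ∑ i, ‖z i t‖ ^ 2 ≤ 8 * n * K} := by
  set S := {z : Fin K → Fin n → ℂ | (∀ i, c.dec i (fun t => c.signal H i w t + z i t) = w i) ∧
        ∑ t, ∑ i, ‖z i t‖ ^ 2 ≤ 8 * n * K}
  set E := {z : Fin K → Fin n → ℂ | (8 * n * K : ℝ) < ∑ t, ∑ i, ‖z i t‖ ^ 2}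
  set B : Fin K → Set (Fin n → ℂ) := fun i =>
    {z | c.dec i (fun t => c.signal H i w t + z t) ≠ w i}
  have hB : ∀ i, MeasurableSet (B i) := fun i => by
    have h : Measurable fun z : Fin n → ℂ => c.dec i (fun t => c.signal H i w t + z t) :=
      (c.measurable_dec i).comp (by fun_prop)
    exact (h (measurableSet_singleton (w i))).compl
  have hcover : (Set.univ : Set (Fin K → Fin n → ℂ)) ⊆
      (S ∪ E) ∪ ⋃ i, Function.eval i ⁻¹' B i := by
    intro z _
    by_cases h1 : ∀ i, c.dec i (fun t => c.signal H i w t + z i t) = w i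
    · left
      rcases le_or_gt (∑ t, ∑ i, ‖z i t‖ ^ 2) (8 * n * K : ℝ) with h2 | h2
      · exact Or.inl ⟨h1, h2⟩
      · exact Or.inr h2
    · right
      obtain ⟨i, hi⟩ := not_forall.1 h1
      exact Set.mem_iUnion.2 ⟨i, hi⟩
  have h1 : (1 : ℝ) ≤ (jointNoise K n).real ((S ∪ E) ∪ ⋃ i, Function.eval i ⁻¹' B i) := by
    rw [← probReal_univ (μ := jointNoise K n)]
    exact measureReal_mono hcover
  have h2 := measureReal_union_le (μ := jointNoise K n) (S ∪ E) (⋃ i, Function.eval i ⁻¹' B i)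
  have h3 := measureReal_union_le (μ := jointNoise K n) S E
  have h4 : (jointNoise K n).real E ≤ 1 / 8 :=
    ENNReal.toReal_le_of_le_ofReal (by norm_num) (jointNoise_energy_gt hK hn)
  have h5 : (jointNoise K n).real (⋃ i, Function.eval i ⁻¹' B i) ≤
      ∑ i, (noiseLaw n).real (B i) := by
    refine (measureReal_iUnion_fintype_le _).trans (Finset.sum_le_sum fun i _ => le_of_eq ?_)
    rw [measureReal_def, measureReal_def, (measurePreserving_eval_jointNoise i).measure_preimage
      (hB i).nullMeasurableSet]
  linarith

/-- The packing bound: a code with small error probabilities has at most about as many messages as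
the volume of the well-predicted outputs permits. -/
lemma numMessages_le (c : Code T n) {H L : Realization K} {A V : Finset (Fin K)}
    (hT : ∀ i, i ∉ A → T i ⊆ V) {good : Finset (Fin n)} {P m : ℝ} (hP : 0 < P) (hm : 0 ≤ m)
    (hL : ∀ t : Fin n, t ∈ good → IsPredictor A V (H t) (L t) ∧ gain (L t) ≤ m)
    (hK : 0 < K) (hn : 0 < n) (hpow : ∀ j, c.power j ≤ P)
    (herr : ∀ i, c.errorProb H i ≤ 1 / (8 * K)) :
    (c.numMessages : ℝ) / 2 ≤
      Real.exp (24 * K ^ 2 * n) * ∏ i, ∏ t, (Real.pi * scale H A good P m i t) := by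
  have hv : ∀ i t, 0 < scale H A good P m i t := scale_pos H A good hP.le hm
  have hN : (0 : ℝ) < c.numMessages := by exact_mod_cast c.numMessages_pos
  have hn' : (0 : ℝ) < n := by exact_mod_cast hn
  have hK' : (0 : ℝ) < K := by exact_mod_cast hK
  set W := Finset.univ.filter fun w => ¬ 4 * n * K * P < c.energy w
  set err : Fin K → ((i : Fin K) → Fin (c.size i)) → ℝ := fun i w =>
    (noiseLaw n).real {z | c.dec i (fun t => c.signal H i w t + z t) ≠ w i}
  set Q : ((i : Fin K) → Fin (c.size i)) → Set (Fin K → Fin n → ℂ) := fun w =>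
    {z | (∀ i, c.dec i (fun t => c.signal H i w t + z i t) = w i) ∧
        ∑ i, ∑ t, ‖(c.signal H i w t + z i t) - c.prediction H L A V good
          (fun i t => c.signal H i w t + z i t) i t‖ ^ 2 / scale H A good P m i t ≤
            24 * K ^ 2 * n}
  have herr0 : ∀ i w, 0 ≤ err i w := fun i w => measureReal_nonneg
  have hupper : ∑ w, (jointNoise K n).real (Q w) ≤
      Real.exp (24 * K ^ 2 * n) * ∏ i, ∏ t, (Real.pi * scale H A good P m i t) := by
    have h := c.sum_prob_le H L A V good hv (24 * K ^ 2 * n)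
    have h' := ENNReal.toReal_le_of_le_ofReal (mul_nonneg (Real.exp_pos _).le
      (Finset.prod_nonneg fun i _ => Finset.prod_nonneg fun t _ =>
        (mul_pos Real.pi_pos (hv i t)).le)) h
    rwa [ENNReal.toReal_sum fun w _ => measure_ne_top _ _] at h'
  have hlower : ∀ w ∈ W, 1 - 1 / 8 - ∑ i, err i w ≤ (jointNoise K n).real (Q w) := by
    intro w hw
    refine (c.one_sub_le_prob_correct H hK hn w).trans (measureReal_mono fun z hz => ⟨hz.1, ?_⟩)
    have hE : c.energy w ≤ 4 * n * K * P := not_lt.1 (Finset.mem_filter.1 hw).2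
    have hE' : c.energy w / (1 + P) ≤ 4 * n * K := by
      rw [div_le_iff₀ (by positivity)]
      nlinarith [mul_pos hn' hK']
    -- The energies `4 n K P` of the codewords and `8 n K` of the noise bound the prediction error.
    calc _ ≤ ∑ i : Fin K, ∑ t : Fin n,
          (2 * ((∑ j, ‖c.enc j w t‖ ^ 2) / (1 + P)) + 2 * ∑ k, ‖z k t‖ ^ 2) :=
          Finset.sum_le_sum fun i _ => Finset.sum_le_sum fun t _ =>
            c.norm_sub_prediction_sq_le hT hP.le hm hL (fun _ _ => rfl) hz.1 i t
      _ = K * (2 * (c.energy w / (1 + P)) + 2 * ∑ t, ∑ k, ‖z k t‖ ^ 2) := by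
          simp only [Finset.sum_const, Finset.card_univ, Fintype.card_fin, nsmul_eq_mul,
            Finset.sum_add_distrib, ← Finset.mul_sum, ← Finset.sum_div]
          rfl
      _ ≤ K * (2 * (4 * n * K) + 2 * (8 * n * K)) := by
          have := hz.2
          gcongr
      _ = 24 * K ^ 2 * n := by ring
  have hcard : 3 / 4 * (c.numMessages : ℝ) ≤ W.card := by
    have h1 := c.card_energy_gt_le hP hK hn hpow
    have h2 := Finset.card_filter_add_card_filter_not (s := Finset.univ)
      (fun w => 4 * n * K * P < c.energy w)
    rw [Finset.card_univ, c.card_messages] at h2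
    have h3 : ((Finset.univ.filter fun w => 4 * n * K * P < c.energy w).card : ℝ) + W.card =
      c.numMessages := by rw [← Nat.cast_add, h2]
    linarith
  have herrsum : ∑ w, ∑ i, err i w ≤ c.numMessages / 8 := by
    rw [Finset.sum_comm]
    have h1 : ∀ i, ∑ w, err i w ≤ 1 / (8 * K) * c.numMessages := fun i => by
      have := herr i
      rwa [errorProb, div_le_iff₀ hN] at this
    refine (Finset.sum_le_sum fun i _ => h1 i).trans_eq ?_
    simp
    field_simp
  have hsumW : ∑ w ∈ W, (1 - 1 / 8 - ∑ i, err i w) ≤ ∑ w, (jointNoise K n).real (Q w) :=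
    (Finset.sum_le_sum hlower).trans
      (Finset.sum_le_univ_sum_of_nonneg fun w => measureReal_nonneg)
  have herrW : ∑ w ∈ W, ∑ i, err i w ≤ ∑ w, ∑ i, err i w :=
    Finset.sum_le_univ_sum_of_nonneg fun w => Finset.sum_nonneg fun i _ => herr0 i w
  rw [Finset.sum_sub_distrib, Finset.sum_const, nsmul_eq_mul] at hsumW
  linarith

/-- The packing bound for the sum of the rates. -/
lemma sum_rate_le (c : Code T n) {H L : Realization K} {A V : Finset (Fin K)}
    (hT : ∀ i, i ∉ A → T i ⊆ V) {good : Finset (Fin n)} {P m : ℝ} (hP : 0 < P) (hm : 0 ≤ m)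
    (hL : ∀ t : Fin n, t ∈ good → IsPredictor A V (H t) (L t) ∧ gain (L t) ≤ m)
    (hK : 0 < K) (hn : 0 < n) (hpow : ∀ j, c.power j ≤ P)
    (herr : ∀ i, c.errorProb H i ≤ 1 / (8 * K)) :
    ∑ i, c.rate i ≤ Real.log 2 + 24 * K ^ 2 + K * Real.log Real.pi + K * Real.log (1 + m) +
      K * ((∑ t : Fin n, Real.log (1 + gain (H t))) / n) +
      (A.card + K * ((goodᶜ.card : ℝ) / n)) * Real.log (1 + P) := by
  have hv : ∀ i t, 0 < scale H A good P m i t := scale_pos H A good hP.le hm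
  have hN : (0 : ℝ) < c.numMessages := by exact_mod_cast c.numMessages_pos
  have hn' : (1 : ℝ) ≤ n := by exact_mod_cast hn
  have hpi : ∀ i t, 0 < Real.pi * scale H A good P m i t := fun i t =>
    mul_pos Real.pi_pos (hv i t)
  have hlogP : 0 ≤ Real.log (1 + P) := Real.log_nonneg (by linarith)
  have hlogm : 0 ≤ Real.log (1 + m) := Real.log_nonneg (by linarith)
  have h1 : ∑ i, Real.log (c.size i) ≤ Real.log 2 + 24 * K ^ 2 * n +
      ∑ i, ∑ t, (Real.log Real.pi + Real.log (scale H A good P m i t)) := by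
    have h := Real.log_le_log (by positivity) (c.numMessages_le hT hP hm hL hK hn hpow herr)
    rw [Real.log_div hN.ne' two_ne_zero, Real.log_mul (Real.exp_pos _).ne'
      (Finset.prod_pos fun i _ => Finset.prod_pos fun t _ => hpi i t).ne', Real.log_exp,
      Real.log_prod fun i _ => (Finset.prod_pos fun t _ => hpi i t).ne', numMessages,
      Nat.cast_prod, Real.log_prod fun i _ => by exact_mod_cast (c.size_pos i).ne'] at h
    have h' : ∀ i, Real.log (∏ t, (Real.pi * scale H A good P m i t)) =
        ∑ t, (Real.log Real.pi + Real.log (scale H A good P m i t)) := fun i => by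
      rw [Real.log_prod fun t _ => (hpi i t).ne']
      exact Finset.sum_congr rfl fun t _ => Real.log_mul Real.pi_ne_zero (hv i t).ne'
    simp_rw [h'] at h
    linarith
  have h2 : ∀ i t, Real.log (scale H A good P m i t) ≤ Real.log (1 + gain (H t)) +
      Real.log (1 + m) + (if i ∈ A then Real.log (1 + P) else 0) +
        (if t ∈ goodᶜ then Real.log (1 + P) else 0) := by
    intro i t
    have hg := gain_nonneg (H t)
    have hlogg : 0 ≤ Real.log (1 + gain (H t)) := Real.log_nonneg (by linarith)
    by_cases hcond : i ∈ A ∨ t ∉ good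
    · rw [scale, if_pos hcond, Real.log_mul (by positivity) (by positivity)]
      rcases hcond with h | h
      · rw [if_pos h]
        split_ifs <;> linarith
      · rw [if_pos (Finset.mem_compl.2 h)]
        split_ifs <;> linarith
    · rw [scale, if_neg hcond]
      split_ifs <;> linarith
  have h3 : ∑ i, ∑ t, (Real.log Real.pi + Real.log (scale H A good P m i t)) ≤
      n * K * Real.log Real.pi + K * ∑ t : Fin n, Real.log (1 + gain (H t)) +
        n * K * Real.log (1 + m) + n * A.card * Real.log (1 + P) +
        K * goodᶜ.card * Real.log (1 + P) := by
    refine (Finset.sum_le_sum fun i _ => Finset.sum_le_sum fun t _ =>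
      add_le_add_right (h2 i t) (Real.log Real.pi)).trans_eq ?_
    simp only [Finset.sum_add_distrib, Finset.sum_const, Finset.card_univ, Fintype.card_fin,
      nsmul_eq_mul, Finset.sum_ite_mem, Finset.univ_inter, ← Finset.mul_sum]
    ring
  have h4 : ∑ i, c.rate i = (∑ i, Real.log (c.size i)) / n := by
    rw [Finset.sum_div]; rfl
  have h5 : 0 ≤ Real.log 2 := Real.log_nonneg (by norm_num)
  rw [h4, div_le_iff₀ (by linarith)]
  refine (h1.trans (add_le_add_right h3 _)).trans ?_
  have h6 : Real.log 2 ≤ Real.log 2 * n := le_mul_of_one_le_right h5 hn'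
  have h7 : (Real.log 2 + 24 * K ^ 2 + K * Real.log Real.pi + K * Real.log (1 + m) +
      K * ((∑ t : Fin n, Real.log (1 + gain (H t))) / n) +
      (A.card + K * ((goodᶜ.card : ℝ) / n)) * Real.log (1 + P)) * n =
      Real.log 2 * n + 24 * K ^ 2 * n + (n * K * Real.log Real.pi +
        K * ∑ t : Fin n, Real.log (1 + gain (H t)) +
        n * K * Real.log (1 + m) + n * A.card * Real.log (1 + P) +
        K * goodᶜ.card * Real.log (1 + P)) := by
    field_simp
    ring
  rw [h7]
  linarith

end Code

end Converse

/-! ### From rates to degrees of freedom -/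

section DegreesOfFreedom

variable {K : ℕ}

/-- Every channel matrix outside `B` has a predictor of total squared gain at most `m`. -/
def PredictableOff (A V : Finset (Fin K)) (B : Set (Fin K → Fin K → ℂ)) (m : ℝ) : Prop :=
  ∀ M, M ∉ B → ∃ L, IsPredictor A V M L ∧ gain L ≤ m

/-- The property of a channel realization on which the bound on the degrees of freedom rests: its
gains have bounded logarithmic mean, and the frequency of the time slots without a predictor of
gain at most `m` is as small as desired for suitable `m`. -/
def IsRegular (A V : Finset (Fin K)) (H : Realization K) : Prop :=
  (∃ C, ∀ᶠ n : ℕ in atTop, (∑ t ∈ Finset.range n, Real.log (1 + gain (H t))) / n ≤ C) ∧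
    ∀ θ > 0, ∃ m ≥ 0, ∃ B, PredictableOff A V B m ∧
      ∀ᶠ n : ℕ in atTop, (∑ t ∈ Finset.range n, B.indicator 1 (H t)) / n ≤ (θ : ℝ)

lemma sum_achievableRate_le {T : Fin K → Finset (Fin K)} {H : Realization K}
    {A V : Finset (Fin K)} (hK : 0 < K) (hT : ∀ i, i ∉ A → T i ⊆ V) (hH : IsRegular A V H)
    {θ : ℝ} (hθ : 0 < θ) :
    ∃ C, ∀ P > 0, ∀ R, AchievableRate T H P R →
      ∑ i, R i ≤ C + (A.card + K * θ) * Real.log (1 + P) := by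
  classical
  obtain ⟨⟨C, hC⟩, h2⟩ := hH
  obtain ⟨m, hm, B, hB, hfreq⟩ := h2 θ hθ
  refine ⟨Real.log 2 + 24 * K ^ 2 + K * Real.log Real.pi + K * Real.log (1 + m) + K * C,
    fun P hP R hR => ?_⟩
  have hK' : (0 : ℝ) < K := by exact_mod_cast hK
  obtain ⟨N, hN⟩ := hR (1 / (8 * K)) (by positivity)
  obtain ⟨n, hn, hnN, hnC, hnfreq⟩ :=
    ((eventually_gt_atTop 0).and ((eventually_ge_atTop N).and (hC.and hfreq))).exists
  obtain ⟨c, hpow, hrate, herr⟩ := hN n hnN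
  choose! L hL using hB
  set good : Finset (Fin n) := Finset.univ.filter fun t => H t ∉ B
  have h := c.sum_rate_le (L := fun t => L (H t)) hT (good := good) hP hm
    (fun t ht => hL _ (Finset.mem_filter.1 ht).2) hK hn hpow herr
  have hbad : (goodᶜ.card : ℝ) = ∑ t ∈ Finset.range n, B.indicator 1 (H t) := by
    rw [Finset.sum_range fun t => B.indicator (1 : (Fin K → Fin K → ℂ) → ℝ) (H t)]
    have : goodᶜ = Finset.univ.filter fun t : Fin n => H t ∈ B := by
      ext t; simp [good]
    rw [this, Finset.card_filter, Nat.cast_sum]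
    refine Finset.sum_congr rfl fun t _ => ?_
    by_cases ht : H t ∈ B <;> simp [ht]
  rw [hbad, ← Finset.sum_range fun t => Real.log (1 + gain (H t))] at h
  have hlogP : 0 ≤ Real.log (1 + P) := Real.log_nonneg (by linarith)
  calc ∑ i, R i ≤ ∑ i, c.rate i := Finset.sum_le_sum fun i _ => hrate i
    _ ≤ _ := h
    _ ≤ _ := by gcongr

/-- Receivers `A` whose outputs determine all messages bound the total degrees of freedom. -/
lemma sum_dof_le_card {law : Measure (Realization K)} [IsProbabilityMeasure law]
    {T : Fin K → Finset (Fin K)} {A V : Finset (Fin K)} (hK : 0 < K)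
    (hT : ∀ i, i ∉ A → T i ⊆ V) (hreg : ∀ᵐ H ∂law, IsRegular A V H) {d : Fin K → ℝ}
    (hd : AchievableDoF law T d) : ∑ i, d i ≤ A.card := by
  obtain ⟨R, hR, hlim⟩ := hd
  -- Along integer powers, a single channel realization serves all powers at once.
  have hae : ∀ᵐ H ∂law, ∀ p : ℕ, AchievableRate T H (p + 1 : ℕ) (R (p + 1 : ℕ)) :=
    ae_all_iff.2 fun p => (hR _ (by positivity)).2
  obtain ⟨H, hH, hHR⟩ := (hreg.and hae).exists
  refine le_of_forall_pos_le_add fun ε hε => ?_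
  have hK' : (0 : ℝ) < K := by exact_mod_cast hK
  obtain ⟨C, hC⟩ := sum_achievableRate_le hK hT hH (θ := ε / K) (by positivity)
  have hnat : Tendsto (fun p : ℕ => ((p + 1 : ℕ) : ℝ)) atTop atTop :=
    tendsto_natCast_atTop_atTop.comp (tendsto_add_atTop_nat 1)
  have h1 : Tendsto (fun p : ℕ => ∑ i, R (p + 1 : ℕ) i / Real.log (p + 1 : ℕ)) atTop
      (𝓝 (∑ i, d i)) := tendsto_finsetSum _ fun i _ => (hlim i).comp hnat
  have h2 : Tendsto (fun p : ℕ => (C + (A.card + ε) * Real.log 2) / Real.log (p + 1 : ℕ) +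
      (A.card + ε)) atTop (𝓝 (0 + (A.card + ε))) :=
    ((Real.tendsto_log_atTop.comp hnat).const_div_atTop _).add_const _
  rw [zero_add] at h2
  refine le_of_tendsto_of_tendsto h1 h2 ?_
  filter_upwards [eventually_gt_atTop 0] with p hp
  have hp1 : (1 : ℝ) < (p + 1 : ℕ) := by exact_mod_cast Nat.lt_add_of_pos_left hp
  have hlog : 0 < Real.log (p + 1 : ℕ) := Real.log_pos hp1
  have hCp := hC _ (zero_lt_one.trans hp1) _ (hHR p)
  rw [mul_div_cancel₀ _ hK'.ne'] at hCp
  have hlog2 : Real.log (1 + (p + 1 : ℕ)) ≤ Real.log 2 + Real.log (p + 1 : ℕ) := by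
    rw [← Real.log_mul two_ne_zero (by positivity)]
    exact Real.log_le_log (by positivity) (by linarith)
  rw [← Finset.sum_div, div_add' _ _ _ hlog.ne', div_le_div_iff_of_pos_right hlog]
  have : (0 : ℝ) ≤ A.card + ε := by positivity
  nlinarith [mul_le_mul_of_nonneg_left hlog2 this]

lemma dof_le_card {law : Measure (Realization K)} [IsProbabilityMeasure law]
    {T : Fin K → Finset (Fin K)} {A V : Finset (Fin K)} (hK : 0 < K)
    (hT : ∀ i, i ∉ A → T i ⊆ V) (hreg : ∀ᵐ H ∂law, IsRegular A V H) :
    dof law T ≤ A.card := by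
  refine iSup₂_le fun d hd => ?_
  have hsub : dofRegion law T ⊆ {d | ∑ i, d i ≤ A.card} :=
    closure_minimal (fun d hd => sum_dof_le_card hK hT hreg hd)
      (isClosed_le (by fun_prop) continuous_const)
  rw [← ENNReal.ofReal_natCast]
  exact ENNReal.ofReal_le_ofReal (hsub hd)

/-- The bound `5 / 8` for any sequence of channels that are almost surely regular. -/
lemma tau_three_le {law : (K : ℕ) → Measure (Realization K)} [∀ K, IsProbabilityMeasure (law K)]
    (hreg : ∀ K (A V : Finset (Fin K)), V.card = A.card → ∀ᵐ H ∂law K, IsRegular A V H) :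
    tau law 3 ≤ 5 / 8 := by
  have hbound : ∀ᶠ K : ℕ in atTop,
      dofCoop (law K) 3 / (K : ℝ≥0∞) ≤ 5 / 8 + 5 * (K : ℝ≥0∞)⁻¹ := by
    filter_upwards [eventually_ge_atTop 16] with K hK
    have hdof : dofCoop (law K) 3 ≤ ((5 * (K / 8) + 5 : ℕ) : ℝ≥0∞) := by
      refine iSup₂_le fun T hT => ?_
      obtain ⟨A, V, hV, hA, hAV⟩ := exists_receivers_card_eq hK hT
      rw [← hA]
      exact dof_le_card (by omega) hAV (hreg K A V hV)
    have hK0 : (K : ℝ≥0∞) ≠ 0 := by exact_mod_cast (by omega : K ≠ 0)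
    rw [ENNReal.div_le_iff hK0 (ENNReal.natCast_ne_top K), add_mul, mul_assoc,
      ENNReal.inv_mul_cancel hK0 (ENNReal.natCast_ne_top K), mul_one]
    refine hdof.trans ?_
    push_cast
    have h8 : ((K / 8 : ℕ) : ℝ≥0∞) ≤ (K : ℝ≥0∞) / 8 := by
      rw [ENNReal.le_div_iff_mul_le (by simp) (by simp)]
      exact_mod_cast Nat.div_mul_le_self K 8
    have h58 : (5 / 8 : ℝ≥0∞) * K = 5 * (K / 8) := by simp only [div_eq_mul_inv]; ring
    rw [h58]
    gcongr
  have hlim : Tendsto (fun K : ℕ => (5 / 8 + 5 * (K : ℝ≥0∞)⁻¹ : ℝ≥0∞)) atTop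
      (𝓝 (5 / 8 + 5 * 0)) :=
    tendsto_const_nhds.add
      (ENNReal.Tendsto.const_mul ENNReal.tendsto_inv_nat_nhds_zero (Or.inr (by simp)))
  rw [mul_zero, add_zero] at hlim
  exact (limsup_le_limsup hbound).trans_eq hlim.limsup_eq

end DegreesOfFreedom

/-! ### Almost every channel realization is regular -/

section Regularity

variable {K : ℕ} (μ : Measure ℂ)

/-- The submatrix of a channel matrix with rows in `A` and columns in `V`. -/
def subchannel (A V : Finset (Fin K)) (hV : V.card = A.card) (M : Fin K → Fin K → ℂ) :
    Matrix (Fin A.card) (Fin A.card) ℂ :=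
  Matrix.of fun p q => M (A.orderEmbOfFin rfl p) (V.orderEmbOfFin hV q)

/-- The predictor obtained from the inverse of the subchannel; a junk value if the subchannel is
singular. -/
def inversePredictor (A V : Finset (Fin K)) (hV : V.card = A.card) (M : Fin K → Fin K → ℂ)
    (b a : Fin K) : ℂ :=
  ∑ p, if A.orderEmbOfFin rfl p = a then
    ∑ q, M b (V.orderEmbOfFin hV q) * (subchannel A V hV M)⁻¹ q p else 0

lemma isPredictor_inversePredictor {A V : Finset (Fin K)} (hV : V.card = A.card)
    {M : Fin K → Fin K → ℂ} (hdet : (subchannel A V hV M).det ≠ 0) :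
    IsPredictor A V M (inversePredictor A V hV M) := by
  intro b j hj
  obtain ⟨q₀, rfl⟩ : ∃ q, V.orderEmbOfFin hV q = j := by
    have : j ∈ Set.range (V.orderEmbOfFin hV) := by rwa [Finset.range_orderEmbOfFin]
    exact this
  set e := A.orderEmbOfFin rfl
  set f := V.orderEmbOfFin hV
  set r : Matrix (Fin 1) (Fin A.card) ℂ := Matrix.of fun _ q => M b (f q)
  set c := r * (subchannel A V hV M)⁻¹
  have hc : ∀ a, inversePredictor A V hV M b a = ∑ p, if e p = a then c 0 p else 0 := fun a => rfl
  have hmul : c * subchannel A V hV M = r := by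
    rw [Matrix.mul_assoc, Matrix.nonsing_inv_mul _ (isUnit_iff_ne_zero.2 hdet), Matrix.mul_one]
  calc M b (f q₀) = (c * subchannel A V hV M) 0 q₀ := by rw [hmul]; rfl
    _ = ∑ p, c 0 p * M (e p) (f q₀) := Matrix.mul_apply
    _ = ∑ p, ∑ a ∈ A, (if e p = a then c 0 p else 0) * M a (f q₀) := by
        refine Finset.sum_congr rfl fun p _ => ?_
        rw [Finset.sum_eq_single_of_mem _ (Finset.orderEmbOfFin_mem A rfl p)
          fun a _ ha => by rw [if_neg ha.symm, zero_mul], if_pos rfl]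
    _ = ∑ a ∈ A, inversePredictor A V hV M b a * M a (f q₀) := by
        rw [Finset.sum_comm]
        exact Finset.sum_congr rfl fun a _ => by rw [hc, Finset.sum_mul]

lemma measurable_det_subchannel {A V : Finset (Fin K)} (hV : V.card = A.card) :
    Measurable fun M => (subchannel A V hV M).det :=
  (Continuous.matrix_det (continuous_matrix fun i j => by
    simp only [subchannel, Matrix.of_apply]; fun_prop)).measurable

lemma measurable_gain : Measurable (gain (K := K)) := by unfold gain; fun_prop

lemma measurable_inversePredictor {A V : Finset (Fin K)} (hV : V.card = A.card) :
    Measurable (inversePredictor A V hV) := by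
  have hinv : ∀ q p, Measurable fun M => (subchannel A V hV M)⁻¹ q p := by
    intro q p
    simp only [Matrix.inv_def, Ring.inverse_eq_inv', Matrix.smul_apply, smul_eq_mul]
    refine (measurable_det_subchannel hV).inv.mul ?_
    have : Continuous fun M => (subchannel A V hV M).adjugate :=
      Continuous.matrix_adjugate (continuous_matrix fun i j => by
        simp only [subchannel, Matrix.of_apply]; fun_prop)
    exact (this.matrix_elem q p).measurable
  refine measurable_pi_lambda _ fun b => measurable_pi_lambda _ fun a => ?_
  unfold inversePredictor
  refine Finset.measurable_sum _ fun p _ => ?_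
  split_ifs
  · refine Finset.measurable_sum _ fun q _ => ?_
    have hM : Measurable fun M : Fin K → Fin K → ℂ => M b (V.orderEmbOfFin hV q) := by fun_prop
    exact hM.mul (hinv q p)
  · exact measurable_const

/-- The channel matrices whose subchannel is singular or has an inverse of large gain. -/
def badMatrices (A V : Finset (Fin K)) (hV : V.card = A.card) (m : ℕ) :
    Set (Fin K → Fin K → ℂ) :=
  {M | (subchannel A V hV M).det = 0} ∪ {M | (m : ℝ) < gain (inversePredictor A V hV M)}

lemma measurableSet_badMatrices {A V : Finset (Fin K)} (hV : V.card = A.card) (m : ℕ) :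
    MeasurableSet (badMatrices A V hV m) :=
  (measurableSet_eq_fun (measurable_det_subchannel hV) measurable_const).union
    (measurableSet_lt measurable_const (measurable_gain.comp (measurable_inversePredictor hV)))

lemma predictableOff_badMatrices {A V : Finset (Fin K)} (hV : V.card = A.card) (m : ℕ) :
    PredictableOff A V (badMatrices A V hV m) m := by
  intro M hM
  simp only [badMatrices, Set.mem_union, Set.mem_ofPred_eq, not_or, not_lt] at hM
  exact ⟨_, isPredictor_inversePredictor hV hM.1, hM.2⟩

variable [IsProbabilityMeasure μ]

lemma ae_det_subchannel_ne_zero [NullSingletonClass μ] {A V : Finset (Fin K)}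
    (hV : V.card = A.card) : ∀ᵐ M ∂coeffLaw μ K, (subchannel A V hV M).det ≠ 0 :=
  ae_det_ne_zero μ (A.orderEmbOfFin rfl).injective (V.orderEmbOfFin hV).injective

lemma tendsto_coeffLaw_badMatrices [NullSingletonClass μ] {A V : Finset (Fin K)}
    (hV : V.card = A.card) :
    Tendsto (fun m => (coeffLaw μ K).real (badMatrices A V hV m)) atTop (𝓝 0) := by
  have hanti : Antitone (badMatrices A V hV) := by
    intro m m' h M hM
    refine hM.imp id fun hM => ?_
    have : (m : ℝ) ≤ m' := by exact_mod_cast h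
    exact lt_of_le_of_lt this hM
  have hzero : coeffLaw μ K (⋂ m, badMatrices A V hV m) = 0 := by
    refine measure_mono_null (fun M hM => ?_) (ae_iff.1 (ae_det_subchannel_ne_zero μ hV))
    obtain ⟨m, hm⟩ := exists_nat_ge (gain (inversePredictor A V hV M))
    rcases Set.mem_iInter.1 hM m with h | h
    · exact not_not.2 h
    · exact absurd hm (not_le.2 h)
  have h := tendsto_measure_iInter_atTop (μ := coeffLaw μ K)
    (fun m => (measurableSet_badMatrices hV m).nullMeasurableSet) hanti ⟨0, measure_ne_top _ _⟩
  rw [hzero] at h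
  exact (ENNReal.tendsto_toReal ENNReal.zero_ne_top).comp h

lemma measurable_const_realization :
    Measurable fun (M : Fin K → Fin K → ℂ) => (fun _ => M : Realization K) :=
  measurable_pi_lambda _ fun _ => measurable_id

instance : IsProbabilityMeasure (constantChannel μ K) :=
  Measure.isProbabilityMeasure_map measurable_const_realization.aemeasurable

instance : IsProbabilityMeasure (varyingChannel μ K) := by
  unfold varyingChannel; infer_instance

lemma isRegular_const {A V : Finset (Fin K)} {M L : Fin K → Fin K → ℂ} (h : IsPredictor A V M L) :
    IsRegular A V fun _ => M := by
  refine ⟨⟨Real.log (1 + gain M), ?_⟩, fun θ hθ => ⟨gain L, gain_nonneg L, {M}ᶜ, ?_, ?_⟩⟩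
  · filter_upwards [eventually_gt_atTop 0] with n hn
    have : (n : ℝ) ≠ 0 := by positivity
    simp [this]
  · intro M' hM'
    obtain rfl : M' = M := by simpa using hM'
    exact ⟨L, h, le_rfl⟩
  · exact Eventually.of_forall fun n => by simpa using hθ.le

lemma ae_isRegular_constantChannel [NullSingletonClass μ] {A V : Finset (Fin K)}
    (hV : V.card = A.card) : ∀ᵐ H ∂constantChannel μ K, IsRegular A V H := by
  have hae : ∀ᵐ H ∂constantChannel μ K, (subchannel A V hV (H 0)).det ≠ 0 ∧ H = fun _ => H 0 := by
    refine (ae_map_iff measurable_const_realization.aemeasurable ?_).2 ?_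
    · refine MeasurableSet.inter (s₁ := {H : Realization K | (subchannel A V hV (H 0)).det ≠ 0}) ?_
        (measurableSet_eq_fun measurable_id ?_)
      · exact (measurableSet_eq_fun
          ((measurable_det_subchannel hV).comp (measurable_pi_apply 0)) measurable_const).compl
      · exact measurable_const_realization.comp (measurable_pi_apply 0)
    · filter_upwards [ae_det_subchannel_ne_zero μ hV] with M hM
      exact ⟨hM, rfl⟩
  filter_upwards [hae] with H hH
  rw [hH.2]
  exact isRegular_const (isPredictor_inversePredictor hV hH.1)

/-- The strong law of large numbers for functionals of the channel matrices of the time-varying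
channel. -/
lemma ae_tendsto_average_varyingChannel {f : (Fin K → Fin K → ℂ) → ℝ} (hf : Measurable f)
    (hint : Integrable f (coeffLaw μ K)) :
    ∀ᵐ H ∂varyingChannel μ K,
      Tendsto (fun n : ℕ => (∑ t ∈ Finset.range n, f (H t)) / n) atTop
        (𝓝 (∫ M, f M ∂coeffLaw μ K)) := by
  have hmp : ∀ t : ℕ, MeasurePreserving (Function.eval t) (varyingChannel μ K) (coeffLaw μ K) :=
    fun t => measurePreserving_eval_infinitePi (fun _ : ℕ => coeffLaw μ K) t
  have hindep : iIndepFun (fun (t : ℕ) (H : Realization K) => f (H t)) (varyingChannel μ K) :=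
    iIndepFun_infinitePi (P := fun _ : ℕ => coeffLaw μ K) (X := fun _ => f) fun _ => hf
  have h := strong_law_ae_real (μ := varyingChannel μ K)
    (fun (t : ℕ) (H : Realization K) => f (H t)) ((hmp 0).integrable_comp_of_integrable hint)
    (fun s t hst => hindep.indepFun hst) fun t =>
      ⟨(hf.comp (measurable_pi_apply t)).aemeasurable,
        (hf.comp (measurable_pi_apply 0)).aemeasurable, by
          have hmap : ∀ t : ℕ, (varyingChannel μ K).map (fun H => f (H t)) =
              (coeffLaw μ K).map f := fun t => by
            rw [← (hmp t).map_eq, Measure.map_map hf (measurable_pi_apply t)]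
            rfl
          rw [hmap, hmap]⟩
  have hval : ∫ H, f (H 0) ∂varyingChannel μ K = ∫ M, f M ∂coeffLaw μ K := by
    rw [← (hmp 0).map_eq, integral_map (measurable_pi_apply 0).aemeasurable
      hf.aestronglyMeasurable]
  rwa [hval] at h

lemma log_one_add_sq_le {x : ℝ} (hx : 0 ≤ x) :
    Real.log (1 + x ^ 2) ≤ Real.log 2 + 2 * Real.posLog x := by
  rw [Real.posLog_eq_log_max_one hx]
  have h1 : (1 : ℝ) ≤ max 1 x := le_max_left _ _
  have h2 : x ≤ max 1 x := le_max_right _ _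
  have h3 : Real.log 2 + 2 * Real.log (max 1 x) = Real.log (2 * (max 1 x) ^ 2) := by
    rw [Real.log_mul two_ne_zero (by positivity), Real.log_pow]
    simp
  rw [h3]
  exact Real.log_le_log (by positivity) (by nlinarith)

lemma log_one_add_sum_le {ι : Type*} (s : Finset ι) {f : ι → ℝ} (hf : ∀ i, 0 ≤ f i) :
    Real.log (1 + ∑ i ∈ s, f i) ≤ ∑ i ∈ s, Real.log (1 + f i) := by
  classical
  induction s using Finset.induction_on with
  | empty => simp
  | insert a s ha ih =>
    have h1 := hf a
    have h2 : 0 ≤ ∑ i ∈ s, f i := Finset.sum_nonneg fun i _ => hf i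
    rw [Finset.sum_insert ha, Finset.sum_insert ha]
    refine le_trans ?_ (add_le_add_right ih _)
    rw [← Real.log_mul (by positivity) (by positivity)]
    exact Real.log_le_log (by positivity) (by nlinarith)

lemma integrable_log_one_add_gain (hμ : Integrable (fun h : ℂ => Real.posLog ‖h‖) μ) :
    Integrable (fun M => Real.log (1 + gain M)) (coeffLaw μ K) := by
  have hmp : ∀ i j, MeasurePreserving (fun M : Fin K → Fin K → ℂ => M i j) (coeffLaw μ K) μ :=
    fun i j => (measurePreserving_eval (fun _ : Fin K => μ) j).comp
      (measurePreserving_eval (fun _ : Fin K => Measure.pi fun _ : Fin K => μ) i)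
  have hdom : Integrable (fun M : Fin K → Fin K → ℂ =>
      ∑ i, ∑ j, (Real.log 2 + 2 * Real.posLog ‖M i j‖)) (coeffLaw μ K) := by
    refine integrable_finsetSum _ fun i _ => integrable_finsetSum _ fun j _ => ?_
    exact (integrable_const _).add (((hmp i j).integrable_comp_of_integrable hμ).const_mul 2)
  refine hdom.mono' (Real.measurable_log.comp
    (measurable_const.add measurable_gain)).aestronglyMeasurable (ae_of_all _ fun M => ?_)
  rw [Real.norm_of_nonneg (Real.log_nonneg (by linarith [gain_nonneg M]))]
  refine (log_one_add_sum_le _ fun i => by positivity).trans (Finset.sum_le_sum fun i _ => ?_)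
  exact (log_one_add_sum_le _ fun j => by positivity).trans
    (Finset.sum_le_sum fun j _ => log_one_add_sq_le (norm_nonneg _))

lemma ae_isRegular_varyingChannel [NullSingletonClass μ]
    (hμ : Integrable (fun h : ℂ => Real.posLog ‖h‖) μ) {A V : Finset (Fin K)}
    (hV : V.card = A.card) : ∀ᵐ H ∂varyingChannel μ K, IsRegular A V H := by
  have h1 := ae_tendsto_average_varyingChannel (K := K) μ
    (Real.measurable_log.comp (measurable_const.add measurable_gain))
    (integrable_log_one_add_gain μ hμ)
  have h2 : ∀ᵐ H ∂varyingChannel μ K, ∀ m : ℕ, Tendsto (fun n : ℕ =>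
      (∑ t ∈ Finset.range n, (badMatrices A V hV m).indicator 1 (H t)) / (n : ℝ)) atTop
        (𝓝 ((coeffLaw μ K).real (badMatrices A V hV m))) := by
    refine ae_all_iff.2 fun m => ?_
    rw [← integral_indicator_one (measurableSet_badMatrices hV m)]
    exact ae_tendsto_average_varyingChannel μ
      (measurable_one.indicator (measurableSet_badMatrices hV m))
      ((integrable_const 1).indicator (measurableSet_badMatrices hV m))
  filter_upwards [h1, h2] with H hH1 hH2
  refine ⟨⟨_, hH1.eventually_le_const (lt_add_one _)⟩, fun θ hθ => ?_⟩
  obtain ⟨m, hm⟩ := ((tendsto_coeffLaw_badMatrices μ hV).eventually_lt_const hθ).exists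
  exact ⟨m, m.cast_nonneg, _, predictableOff_badMatrices hV m, (hH2 m).eventually_le_const hm⟩

end Regularity

end CoMP

end

theorem mainTheorem8 (μ : MeasureTheory.Measure ℂ) [MeasureTheory.IsProbabilityMeasure μ]
    [MeasureTheory.NullSingletonClass μ] :
    CoMP.tau (CoMP.constantChannel μ) 3 ≤ 5 / 8 ∧
    (MeasureTheory.Integrable (fun h : ℂ => Real.posLog ‖h‖) μ →
      CoMP.tau (CoMP.varyingChannel μ) 3 ≤ 5 / 8) :=
  ⟨CoMP.tau_three_le fun _ _ _ hV => CoMP.ae_isRegular_constantChannel μ hV,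
    fun hμ => CoMP.tau_three_le fun _ _ _ hV => CoMP.ae_isRegular_varyingChannel μ hμ hV⟩
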